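/- **Setting.** Let $R$ be a finite monoid with group of units $W$ and set of idempotents $E(R)$, ordered by $e\le f \iff ef=fe=e$. Let $S\subseteq W$ and $\Lambda\subseteq E(R)$, and for $I\subseteq S$ let $W_I=\langle I\rangle$. Assume that $(R,\Lambda,S)$ is a (generalized) Renner-Coxeter system, that is: (i) $R$ is factorizable: $R=E(R)W=WE(R)$, and $E(R)$ is a meet semilattice with meet $e\wedge f=ef=fe$; (ii) every $W$-conjugacy class in $E(R)$ meets $\Lambda$ in exactly one element, and $\Lambda$ is closed under products; (iii) $(W,S)$ is a Coxeter system; (iv) for all $e\le e'$ in $E(R)$ there are $w\in W$ and $f\le f'$ in $\Lambda$ with $wew^{-1}=f$ and $we'w^{-1}=f'$; (v) if $e\le f$ in $\Lambda$, then $\lambda^*(e)\subseteq\lambda^*(f)$, where $\lambda^*(e)=\{s\in S: se=es\ne e\}$; (vi) for each $e\in\Lambda$ the groups $\{w\in W: we=ew\}$ and $\{w\in W: we=ew=e\}$ are standard parabolic subgroups of $W$. For an idempotent $e$ put $\lambda(e)=\{s\in S: se=es\}$ and $\lambda_*(e)=\{s\in S: se=es=e\}$; for $e\in\Lambda$ the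 two groups in (vi) are $W_{\lambda(e)}$ and $W_{\lambda_*(e)}$. On $W$ let $\le$ be the Bruhat order and $w_0$ the longest element. For $I,J\subseteq S$ let ${}^Iw^J$ denote the minimum of $W_IwW_J$ for $\le$, and let ${}^IW^J=\{w\in W: w={}^Iw^J\}$; an empty $I$ or $J$ is omitted from the notation. Every $r\in R$ has a unique left standard form $r=xey$ ($e\in\Lambda$, $x\in W^{\lambda_*(e)}$, $y\in{}^{\lambda(e)}W$) and a unique right standard form $r=yex$ ($e\in\Lambda$, $y\in W^{\lambda(e)}$, $x\in{}^{\lambda_*(e)}W$). The adherence orders $\le^+$ and $\le^-$ on $R$ are defined as follows. * If $r=xey$ and $s=afb$ are in left standard form, then $r\le^+ s$ iff $e\le f$ and there is $w\in W_{\lambda^*(f)}W_{\lambda_*(e)}$ with $x\le aw$ and $w^{-1}b\le y$. * If $r=yex$ and $s=bfa$ are in right standard form, then $r\le^- s$ iff $e\le f$ and there is $w\in W_{\lambda_*(e)}W_{\lambda^*(f)}$ with $x\le wa$ and $bw^{-1}\le y$. Let $\Lambda^+=\Lambda$ and $\Lambda^-=w_0\Lambda w_0$. Let $\mathcal L,\mathcal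 R,\mathcal J$ be Green's relations ($Rr=Rs$, $rR=sR$, $RrR=RsR$ respectively) and $\mathcal H=\mathcal L\cap\mathcal R$. For $\varepsilon\in\{+,-\}$, a *vanilla form* of $r$ in $(R,\Lambda^\varepsilon,S)$ is an expression $r=\sigma_-e_-\sigma_0e_+\sigma_+$ with $e_+\in\Lambda^\varepsilon$, $e_-\in w_0\Lambda^\varepsilon w_0$, $e_-\mathrel{\mathcal J}r\mathrel{\mathcal J}e_+$, $\sigma_+\in{}^{\lambda(e_+)}W$, $\sigma_-\in W^{\lambda(e_-)}$, and $\sigma_0\in W_{\lambda^*(e_-)}\bigl({}^{\lambda_*(e_-)}w_0^{\lambda_*(e_+)}\bigr)W_{\lambda^*(e_+)}$. For $T\in\{H,L,R,J\}$ let $T_r$ be the class of $r$ under the corresponding Green relation; $\min^\varepsilon T_r$ (resp. $\max^\varepsilon T_r$) is the element $m\in T_r$ with $m\le^\varepsilon t$ (resp. $t\le^\varepsilon m$) for all $t\in T_r$. **Theorem.** Let $\varepsilon\in\{+,-\}$. For every $r\in R$ and every $T\in\{H,L,R,J\}$, the absolute minimum $\min^\varepsilon T_r$ and the absolute maximum $\max^\varepsilon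 T_r$ exist and are unique. Every $r\in R$ has a unique vanilla form $r=\sigma_-e_-\sigma_0e_+\sigma_+$ in $(R,\Lambda^\varepsilon,S)$, and for it: 1. $r=\min^\varepsilon H_r$ iff $\sigma_0={}^{\lambda(e_-)}w_0^{\lambda(e_+)}$; 2. $r=\min^\varepsilon L_r$ iff $\sigma_-={}^{\lambda(e_+)}w_0^{\lambda(e_-)}$ and $\sigma_0={}^{\lambda(e_-)}w_0^{\lambda(e_+)}$; 3. $r=\min^\varepsilon R_r$ iff $\sigma_0={}^{\lambda(e_-)}w_0^{\lambda(e_+)}$ and $\sigma_+={}^{\lambda(e_+)}w_0^{\lambda(e_-)}$; 4. $r=\min^\varepsilon J_r$ iff $\sigma_-={}^{\lambda(e_+)}w_0^{\lambda(e_-)}$, $\sigma_0={}^{\lambda(e_-)}w_0^{\lambda(e_+)}$ and $\sigma_+={}^{\lambda(e_+)}w_0^{\lambda(e_-)}$; 5. $r=\max^\varepsilon H_r$ iff $\sigma_0={}^{\lambda_*(e_-)}w_0^{\lambda_*(e_+)}$; 6. $r=\max^\varepsilon L_r$ iff $\sigma_-=1$ and $\sigma_0={}^{\lambda_*(e_-)}w_0^{\lambda_*(e_+)}$;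 7. $r=\max^\varepsilon R_r$ iff $\sigma_0={}^{\lambda_*(e_-)}w_0^{\lambda_*(e_+)}$ and $\sigma_+=1$; 8. $r=\max^\varepsilon J_r$ iff $\sigma_-=1$, $\sigma_0={}^{\lambda_*(e_-)}w_0^{\lambda_*(e_+)}$ and $\sigma_+=1$. -/

import Mathlib

/-!
Renner-Coxeter monoids, their adherence orders, Green's relations and vanilla form.

A Coxeter system `(W, S)` is Mathlib's `CoxeterSystem M W`; the generating set `S` is the family
`cs.simple : B → W`, and subsets of `S` are given by subsets of the index type `B`.
-/

namespace RennerCoxeter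

section Coxeter

/-- The Bruhat order: some reduced word of `v` has a subword which is a reduced word of `u`. -/
def BruhatLE {B W : Type*} [Group W] {M : CoxeterMatrix B} (cs : CoxeterSystem M W)
    (u v : W) : Prop :=
  ∃ ω ω' : List B, cs.IsReduced ω ∧ cs.wordProd ω = v ∧
    cs.IsReduced ω' ∧ cs.wordProd ω' = u ∧ List.Sublist ω' ω

/-- The standard parabolic subgroup `W_I` generated by the simple reflections in `I`. -/
def parabolic {B W : Type*} [Group W] {M : CoxeterMatrix B} (cs : CoxeterSystem M W)
    (I : Set B) : Subgroup W :=
  Subgroup.closure (cs.simple '' I)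

/-- The double coset `W_I w W_J`. -/
def doubleCoset {B W : Type*} [Group W] {M : CoxeterMatrix B} (cs : CoxeterSystem M W)
    (I J : Set B) (w : W) : Set W :=
  {v | ∃ a ∈ parabolic cs I, ∃ b ∈ parabolic cs J, v = a * w * b}

/-- `m = ^I w ^J`: the element `m` is the minimum, for the Bruhat order, of `W_I w W_J`. -/
def IsMinRep {B W : Type*} [Group W] {M : CoxeterMatrix B} (cs : CoxeterSystem M W)
    (I J : Set B) (w m : W) : Prop :=
  m ∈ doubleCoset cs I J w ∧ ∀ v ∈ doubleCoset cs I J w, BruhatLE cs m v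

/-- The set `^I W ^J` of minimum double coset representatives. -/
def minReps {B W : Type*} [Group W] {M : CoxeterMatrix B} (cs : CoxeterSystem M W)
    (I J : Set B) : Set W :=
  {u | ∀ v ∈ doubleCoset cs I J u, BruhatLE cs u v}

/-- The longest element `w₀` of a finite Coxeter group: an element of maximum length. -/
noncomputable def longest {B W : Type*} [Group W] [Finite W] {M : CoxeterMatrix B}
    (cs : CoxeterSystem M W) : W :=
  Classical.choose (Finite.exists_max cs.length)

theorem length_le_length_longest {B W : Type*} [Group W] [Finite W] {M : CoxeterMatrix B}
    (cs : CoxeterSystem M W) (w : W) : cs.length w ≤ cs.length (longest cs) :=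
  Classical.choose_spec (Finite.exists_max cs.length) w

end Coxeter

section System

/-- The order `e ≤ f ↔ ef = fe = e` on idempotents. -/
def IdemLE {R : Type*} [Monoid R] (e f : R) : Prop :=
  e * f = e ∧ f * e = e

/-- A factorizable monoid: unit regular, and its idempotents form a meet semilattice, the meet
being the product (so that idempotents commute). -/
structure IsFactorizable (R : Type*) [Monoid R] : Prop where
  exists_idem_mul_unit : ∀ r : R, ∃ e : R, IsIdempotentElem e ∧ ∃ w : Rˣ, r = e * w
  exists_unit_mul_idem : ∀ r : R, ∃ e : R, IsIdempotentElem e ∧ ∃ w : Rˣ, r = w * e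
  idem_comm : ∀ e f : R, IsIdempotentElem e → IsIdempotentElem f → e * f = f * e

/-- The type map `λ(e)`. On the `Λ` of a Renner-Coxeter system it is the subset of generators whose parabolic
subgroup is the centralizer of `e` in `W`, see `mem_parabolic_typeMap`. -/
def typeMap {B R : Type*} [Monoid R] {M : CoxeterMatrix B} (cs : CoxeterSystem M Rˣ)
    (e : R) : Set B :=
  {i | (cs.simple i : R) * e = e * (cs.simple i : R)}

/-- The lower type map. On the `Λ` of a Renner-Coxeter system it is the subset of generators whose parabolic
subgroup is `{w | we = ew = e}`, see `mem_parabolic_lowerType`. -/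
def lowerType {B R : Type*} [Monoid R] {M : CoxeterMatrix B} (cs : CoxeterSystem M Rˣ)
    (e : R) : Set B :=
  {i | (cs.simple i : R) * e = e ∧ e * (cs.simple i : R) = e}

/-- The upper type map `{s ∈ S | se = es ≠ e}`. -/
def upperType {B R : Type*} [Monoid R] {M : CoxeterMatrix B} (cs : CoxeterSystem M Rˣ)
    (e : R) : Set B :=
  {i | (cs.simple i : R) * e = e * (cs.simple i : R) ∧ e * (cs.simple i : R) ≠ e}

/-- `(R, Λ, S)` is a generalized Renner-Coxeter system, where the Coxeter system `(W, S)` on the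
group of units `W` of `R` is `cs`. -/
structure IsRennerCoxeterSystem {B R : Type*} [Monoid R] {M : CoxeterMatrix B}
    (cs : CoxeterSystem M Rˣ) (Λ : Set R) : Prop where
  /-- `R` is factorizable -/
  factorizable : IsFactorizable R
  /-- `Λ` consists of idempotents -/
  idem : ∀ e ∈ Λ, IsIdempotentElem e
  /-- `Λ` is a transversal for the conjugation action of `W` on idempotents -/
  transversal : ∀ e : R, IsIdempotentElem e → ∃! f : R, f ∈ Λ ∧ ∃ w : Rˣ, w * e * ↑w⁻¹ = f
  /-- `Λ` is a sub meet semilattice -/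
  mul_mem : ∀ e ∈ Λ, ∀ f ∈ Λ, e * f ∈ Λ
  /-- comparable pairs of idempotents can be moved into `Λ` simultaneously -/
  pairs : ∀ e e' : R, IsIdempotentElem e → IsIdempotentElem e' → IdemLE e e' →
    ∃ w : Rˣ, ∃ f ∈ Λ, ∃ f' ∈ Λ, IdemLE f f' ∧ w * e * ↑w⁻¹ = f ∧ w * e' * ↑w⁻¹ = f'
  /-- the upper type map is monotone -/
  upper_mono : ∀ e ∈ Λ, ∀ f ∈ Λ, IdemLE e f → upperType cs e ⊆ upperType cs f
  /-- the centralizer of `e` in `W` is standard parabolic -/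
  centralizer_parabolic : ∀ e ∈ Λ, ∃ I : Set B,
    ∀ w : Rˣ, w ∈ parabolic cs I ↔ (w : R) * e = e * w
  /-- `{w | we = ew = e}` is standard parabolic -/
  fixer_parabolic : ∀ e ∈ Λ, ∃ I : Set B,
    ∀ w : Rˣ, w ∈ parabolic cs I ↔ ((w : R) * e = e ∧ e * w = e)

theorem mem_parabolic_typeMap {B R : Type*} [Monoid R] {M : CoxeterMatrix B}
    {cs : CoxeterSystem M Rˣ} {Λ : Set R} (h : IsRennerCoxeterSystem cs Λ) {e : R} (he : e ∈ Λ)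
    (w : Rˣ) : w ∈ parabolic cs (typeMap cs e) ↔ (w : R) * e = e * w := by
  obtain ⟨I, hI⟩ := h.centralizer_parabolic e he
  have hsub : I ⊆ typeMap cs e := fun i hi =>
    (hI _).1 (Subgroup.subset_closure ⟨i, hi, rfl⟩)
  constructor
  · intro hw
    have hle : parabolic cs (typeMap cs e) ≤ parabolic cs I := by
      refine (Subgroup.closure_le _).2 ?_
      rintro _ ⟨i, hi, rfl⟩
      exact (hI _).2 hi
    exact (hI w).1 (hle hw)
  · intro hw
    exact Subgroup.closure_mono (Set.image_mono hsub) ((hI w).2 hw)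

theorem mem_parabolic_lowerType {B R : Type*} [Monoid R] {M : CoxeterMatrix B}
    {cs : CoxeterSystem M Rˣ} {Λ : Set R} (h : IsRennerCoxeterSystem cs Λ) {e : R} (he : e ∈ Λ)
    (w : Rˣ) : w ∈ parabolic cs (lowerType cs e) ↔ ((w : R) * e = e ∧ e * w = e) := by
  obtain ⟨I, hI⟩ := h.fixer_parabolic e he
  have hsub : I ⊆ lowerType cs e := fun i hi =>
    (hI _).1 (Subgroup.subset_closure ⟨i, hi, rfl⟩)
  constructor
  · intro hw
    have hle : parabolic cs (lowerType cs e) ≤ parabolic cs I := by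
      refine (Subgroup.closure_le _).2 ?_
      rintro _ ⟨i, hi, rfl⟩
      exact (hI _).2 hi
    exact (hI w).1 (hle hw)
  · intro hw
    exact Subgroup.closure_mono (Set.image_mono hsub) ((hI w).2 hw)

end System

section Green

/-- Green's relation `𝓛`: `Rr = Rs`. -/
def GreenL {R : Type*} [Monoid R] (r s : R) : Prop :=
  {x : R | ∃ a, x = a * r} = {x : R | ∃ a, x = a * s}

/-- Green's relation `𝓡`: `rR = sR`. -/
def GreenR {R : Type*} [Monoid R] (r s : R) : Prop :=
  {x : R | ∃ a, x = r * a} = {x : R | ∃ a, x = s * a}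

/-- Green's relation `𝓙`: `RrR = RsR`. -/
def GreenJ {R : Type*} [Monoid R] (r s : R) : Prop :=
  {x : R | ∃ a b, x = a * r * b} = {x : R | ∃ a b, x = a * s * b}

/-- Green's relation `𝓗 = 𝓛 ∩ 𝓡`. -/
def GreenH {R : Type*} [Monoid R] (r s : R) : Prop :=
  GreenL r s ∧ GreenR r s

end Green

section Adherence

/-- `r = xey` is in left standard form: `e ∈ Λ`, `x ∈ W^{λ_*(e)}`, `y ∈ ^{λ(e)}W`. -/
def IsLeftStandardForm {B R : Type*} [Monoid R] {M : CoxeterMatrix B} (cs : CoxeterSystem M Rˣ)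
    (Λ : Set R) (r : R) (x : Rˣ) (e : R) (y : Rˣ) : Prop :=
  r = x * e * y ∧ e ∈ Λ ∧ x ∈ minReps cs ∅ (lowerType cs e) ∧ y ∈ minReps cs (typeMap cs e) ∅

/-- `r = yex` is in right standard form: `e ∈ Λ`, `x ∈ ^{λ_*(e)}W`, `y ∈ W^{λ(e)}`. -/
def IsRightStandardForm {B R : Type*} [Monoid R] {M : CoxeterMatrix B} (cs : CoxeterSystem M Rˣ)
    (Λ : Set R) (r : R) (y : Rˣ) (e : R) (x : Rˣ) : Prop :=
  r = y * e * x ∧ e ∈ Λ ∧ x ∈ minReps cs (lowerType cs e) ∅ ∧ y ∈ minReps cs ∅ (typeMap cs e)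

/-- The adherence order `≤⁺` on `(R, Λ, S)`. -/
def AdhPlus {B R : Type*} [Monoid R] {M : CoxeterMatrix B} (cs : CoxeterSystem M Rˣ)
    (Λ : Set R) (r s : R) : Prop :=
  ∃ (x : Rˣ) (e : R) (y a : Rˣ) (f : R) (b : Rˣ),
    IsLeftStandardForm cs Λ r x e y ∧ IsLeftStandardForm cs Λ s a f b ∧ IdemLE e f ∧
    ∃ u ∈ parabolic cs (upperType cs f), ∃ v ∈ parabolic cs (lowerType cs e),
      BruhatLE cs x (a * (u * v)) ∧ BruhatLE cs ((u * v)⁻¹ * b) y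

/-- The adherence order `≤⁻` on `(R, Λ, S)`. -/
def AdhMinus {B R : Type*} [Monoid R] {M : CoxeterMatrix B} (cs : CoxeterSystem M Rˣ)
    (Λ : Set R) (r s : R) : Prop :=
  ∃ (y : Rˣ) (e : R) (x b : Rˣ) (f : R) (a : Rˣ),
    IsRightStandardForm cs Λ r y e x ∧ IsRightStandardForm cs Λ s b f a ∧ IdemLE e f ∧
    ∃ v ∈ parabolic cs (lowerType cs e), ∃ u ∈ parabolic cs (upperType cs f),
      BruhatLE cs x ((v * u) * a) ∧ BruhatLE cs (b * (v * u)⁻¹) y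

/-- The two values of the sign `ε`. -/
inductive Sign : Type
  | plus : Sign
  | minus : Sign

/-- The adherence order `≤^ε` on `(R, Λ, S)`. -/
def AdhLE {B R : Type*} [Monoid R] {M : CoxeterMatrix B} (cs : CoxeterSystem M Rˣ)
    (Λ : Set R) : Sign → R → R → Prop
  | Sign.plus => AdhPlus cs Λ
  | Sign.minus => AdhMinus cs Λ

/-- `m` is the absolute minimum of the class of `r` under the relation `T`, for `≤^ε`. -/
def IsAbsMin {B R : Type*} [Monoid R] {M : CoxeterMatrix B} (cs : CoxeterSystem M Rˣ)
    (Λ : Set R) (ε : Sign) (T : R → R → Prop) (r m : R) : Prop :=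
  T r m ∧ ∀ t, T r t → AdhLE cs Λ ε m t

/-- `m` is the absolute maximum of the class of `r` under the relation `T`, for `≤^ε`. -/
def IsAbsMax {B R : Type*} [Monoid R] {M : CoxeterMatrix B} (cs : CoxeterSystem M Rˣ)
    (Λ : Set R) (ε : Sign) (T : R → R → Prop) (r m : R) : Prop :=
  T r m ∧ ∀ t, T r t → AdhLE cs Λ ε t m

end Adherence

section Vanilla

/-- The opposite cross-sectional lattice `w₀ Λ w₀`. -/
def opposite {B R : Type*} [Monoid R] [Finite R] {M : CoxeterMatrix B} (cs : CoxeterSystem M Rˣ)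
    (Λ : Set R) : Set R :=
  {e | ∃ f ∈ Λ, e = ((longest cs : Rˣ) : R) * f * ((longest cs : Rˣ) : R)}

/-- The cross-sectional lattice `Λ^ε`: `Λ⁺ = Λ` and `Λ⁻ = w₀ Λ w₀`. -/
def crossSection {B R : Type*} [Monoid R] [Finite R] {M : CoxeterMatrix B}
    (cs : CoxeterSystem M Rˣ) (Λ : Set R) : Sign → Set R
  | Sign.plus => Λ
  | Sign.minus => opposite cs Λ

/-- The data `σ₋, e₋, σ₀, e₊, σ₊` of a decomposition `r = σ₋ e₋ σ₀ e₊ σ₊`. -/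
structure VanillaData (R : Type*) [Monoid R] where
  σm : Rˣ
  em : R
  σz : Rˣ
  ep : R
  σp : Rˣ

/-- `r = σ₋ e₋ σ₀ e₊ σ₊` is in vanilla form in `(R, Λ, S)`. -/
structure IsVanillaForm {B R : Type*} [Monoid R] [Finite R] {M : CoxeterMatrix B}
    (cs : CoxeterSystem M Rˣ) (Λ : Set R) (r : R) (d : VanillaData R) : Prop where
  eq : r = d.σm * d.em * d.σz * d.ep * d.σp
  ep_mem : d.ep ∈ Λ
  em_mem : d.em ∈ opposite cs Λ
  em_green : GreenJ d.em r
  ep_green : GreenJ r d.ep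
  σp_mem : d.σp ∈ minReps cs (typeMap cs d.ep) ∅
  σm_mem : d.σm ∈ minReps cs ∅ (typeMap cs d.em)
  σz_mem : ∃ m : Rˣ, IsMinRep cs (lowerType cs d.em) (lowerType cs d.ep) (longest cs) m ∧
    ∃ a ∈ parabolic cs (upperType cs d.em), ∃ b ∈ parabolic cs (upperType cs d.ep),
      d.σz = a * m * b

end Vanilla

end RennerCoxeter

open RennerCoxeter

/-! Fix `e ∈ Λ` and let wC, wD, wN be the longest elements of the parabolic subgroups of λ(e),
λ^*(e), λ_*(e). A generator in λ^*(e) commutes with e, hence normalizes the fixer W_{λ_*(e)}. This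
forces W_{λ(e)} to be the direct product of W_{λ^*(e)} and W_{λ_*(e)}
(`isProductPair_upperType_lowerType`), so wC = wN wD. It also refines the left standard form r = xey
to r = x₀ d e y with x₀ ∈ W^{λ(e)} and d ∈ W_{λ^*(e)} (`IsNormalForm`). This form is unique and
displays Green's relations: 𝓛 remembers (e, y), 𝓡 remembers (e, x₀), 𝓗 remembers (e, x₀, y), 𝓙
remembers e.

Inside a 𝓙-class the choice w = 1 in the definition of ≤⁺ suffices: r ≤⁺ s follows once x₀d goes up
and y goes down in the Bruhat order. So d runs between 1 and wD, x₀ between 1 and w₀wC, and y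
between wC w₀ (for the minimum) and 1 (for the maximum). Every Bruhat inequality needed comes from a
factorization with additive lengths. Antisymmetry of ≤⁺ (`AdhPlus.antisymm`) makes the extrema
unique.

The vanilla form is the normal form rewritten: σ₋ = x₀ wC w₀, e₋ = w₀ e w₀, σ₀ = w₀ wC d, e₊ = e, σ₊
= y. The minimal double coset representatives in the theorem are w₀ wC, wC w₀ and w₀ wN = w₀ wC wD,
so each criterion becomes a condition on x₀, d and y (`extremal_iff_plus`).

For ≤⁻, note that R is an inverse monoid because its idempotents commute. Inversion turns ≤⁻ into
≤⁺, exchanges 𝓛 with 𝓡, and reverses vanilla forms of w₀Λw₀ into vanilla forms of Λ. -/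

namespace RennerCoxeter

/-! ### The exchange and deletion properties of Coxeter groups. -/

section Exchange

variable {B W : Type*} [Group W] {M : CoxeterMatrix B} (cs : CoxeterSystem M W)

open Classical in
/-- The action of a simple reflection on `W × ℤ/2` which records inversions. -/
noncomputable def signedConj (i : B) : Equiv.Perm (W × ZMod 2) where
  toFun p := (cs.simple i * p.1 * cs.simple i, p.2 + if p.1 = cs.simple i then 1 else 0)
  invFun p := (cs.simple i * p.1 * cs.simple i, p.2 + if p.1 = cs.simple i then 1 else 0)
  left_inv := by
    rintro ⟨t, z⟩
    have h : cs.simple i * t * cs.simple i = cs.simple i ↔ t = cs.simple i := by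
      constructor
      · intro h
        have h' := congrArg (fun u => cs.simple i * u * cs.simple i) h
        simpa [mul_assoc] using h'
      · rintro rfl
        simp
    ext
    · simp [mul_assoc]
    · simp only [h]
      split_ifs
      · rw [add_assoc, CharTwo.add_self_eq_zero, add_zero]
      · simp
  right_inv := by
    rintro ⟨t, z⟩
    have h : cs.simple i * t * cs.simple i = cs.simple i ↔ t = cs.simple i := by
      constructor
      · intro h
        have h' := congrArg (fun u => cs.simple i * u * cs.simple i) h
        simpa [mul_assoc] using h'
      · rintro rfl
        simp
    ext
    · simp [mul_assoc]
    · simp only [h]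
      split_ifs
      · rw [add_assoc, CharTwo.add_self_eq_zero, add_zero]
      · simp

open Classical in
-- Each factor s_i s_j tests two reflections. Since s_j inverts u = s_i s_j, undoing the conjugation
-- by u^n turns these tests into t = s_j u^(2n) and t = s_j u^(2n+1), the two new terms of the sum.
theorem signedConj_mul_pow_apply (i j : B) (n : ℕ) (t : W) (z : ZMod 2) :
    ((signedConj cs i * signedConj cs j) ^ n) (t, z) =
      ((cs.simple i * cs.simple j) ^ n * t * ((cs.simple i * cs.simple j) ^ n)⁻¹,
        z + ∑ k ∈ Finset.range (2 * n),
          if t = cs.simple j * (cs.simple i * cs.simple j) ^ k then 1 else 0) := by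
  induction n with
  | zero => simp
  | succ n ih =>
    set u := cs.simple i * cs.simple j with hu
    have hconj : ∀ k : ℕ, cs.simple j * u ^ k = (u ^ k)⁻¹ * cs.simple j := by
      intro k
      have h1 : cs.simple j * u * (cs.simple j)⁻¹ = u⁻¹ := by simp [hu, mul_assoc]
      have h2 : cs.simple j * u ^ k * (cs.simple j)⁻¹ = (u ^ k)⁻¹ := by
        rw [← conj_pow, h1, inv_pow]
      rw [← h2]; simp [mul_assoc]
    have e1 : u ^ n * t * (u ^ n)⁻¹ = cs.simple j ↔ t = cs.simple j * u ^ (2 * n) := by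
      have h3 : cs.simple j * u ^ (2 * n) = (u ^ n)⁻¹ * cs.simple j * u ^ n := by
        rw [two_mul, pow_add, ← mul_assoc, hconj]
      rw [h3]
      constructor
      · intro h; rw [← h]; group
      · rintro rfl; group
    have e2 : cs.simple j * (u ^ n * t * (u ^ n)⁻¹) * cs.simple j = cs.simple i ↔
        t = cs.simple j * u ^ (2 * n + 1) := by
      have h3 : cs.simple j * u ^ (2 * n + 1) = (u ^ n)⁻¹ * (cs.simple j * u) * u ^ n := by
        rw [show 2 * n + 1 = n + 1 + n by ring, pow_add, pow_succ, ← mul_assoc, ← mul_assoc, hconj]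
        simp [mul_assoc]
      rw [h3]
      constructor
      · intro h
        have h4 : u ^ n * t * (u ^ n)⁻¹ = cs.simple j * u := by
          have h5 := congrArg (fun g => cs.simple j * g * cs.simple j) h
          simpa [hu, mul_assoc] using h5
        rw [← h4]; group
      · rintro rfl
        simp [hu, mul_assoc]
    rw [pow_succ', Equiv.Perm.mul_apply, ih, Equiv.Perm.mul_apply]
    simp only [signedConj, Equiv.coe_fn_mk]
    rw [show 2 * (n + 1) = 2 * n + 1 + 1 by ring, Finset.sum_range_succ, Finset.sum_range_succ]
    ext
    · simp [hu, pow_succ', mul_assoc]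
    · simp only [e1, e2]
      ring

theorem isLiftable_signedConj : M.IsLiftable (signedConj cs) := by
  classical
  intro i j
  ext p : 1
  obtain ⟨t, z⟩ := p
  -- With n = M i j the power u^n is trivial, so the two halves of the sum coincide and cancel
  -- modulo 2.
  rw [signedConj_mul_pow_apply, two_mul, Finset.sum_range_add]
  simp only [pow_add, cs.simple_mul_simple_pow, one_mul, CharTwo.add_self_eq_zero]
  simp

/-- The action of `W` on `W × ℤ/2` which records inversions. -/
noncomputable def signedAction : W →* Equiv.Perm (W × ZMod 2) :=
  cs.lift ⟨signedConj cs, isLiftable_signedConj cs⟩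

open Classical in
theorem signedAction_wordProd (ω : List B) (t : W) (z : ZMod 2) :
    signedAction cs (cs.wordProd ω) (t, z) =
      (cs.wordProd ω * t * (cs.wordProd ω)⁻¹, z + ((cs.rightInvSeq ω).count t : ZMod 2)) := by
  induction ω with
  | nil => simp
  | cons i ω ih =>
    have hs : signedAction cs (cs.simple i) = signedConj cs i :=
      cs.lift_apply_simple (isLiftable_signedConj cs) i
    rw [cs.wordProd_cons, map_mul, Equiv.Perm.mul_apply, ih, hs, CoxeterSystem.rightInvSeq,
      List.count_cons]
    have h : cs.wordProd ω * t * (cs.wordProd ω)⁻¹ = cs.simple i ↔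
        ((cs.wordProd ω)⁻¹ * cs.simple i * cs.wordProd ω == t) = true := by
      rw [beq_iff_eq]
      constructor
      · intro h; rw [← h]; group
      · intro h; rw [← h]; group
    simp only [signedConj, Equiv.coe_fn_mk, h]
    ext
    · simp [mul_assoc]
    · push_cast
      rw [add_assoc]

/-- By `signedAction`, the parity of the number of occurrences of s_i in the inversion sequence
depends only on the group element. Computed through a reduced word of w s_i, in whose sequence s_i
does not occur, it is odd. -/
theorem simple_mem_rightInvSeq (ω : List B) {i : B} (h : cs.IsRightDescent (cs.wordProd ω) i) :
    cs.simple i ∈ cs.rightInvSeq ω := by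
  classical
  obtain ⟨ω', hω', hv⟩ := cs.exists_isReduced (cs.wordProd ω * cs.simple i)
  have hw : cs.wordProd ω = cs.wordProd ω' * cs.simple i := by rw [← hv]; simp
  have hs : signedAction cs (cs.simple i) = signedConj cs i :=
    cs.lift_apply_simple (isLiftable_signedConj cs) i
  have hnot : cs.simple i ∉ cs.rightInvSeq ω' := by
    intro hmem
    have := (cs.isRightInversion_of_mem_rightInvSeq hω' hmem).2
    rw [← hv] at this
    unfold CoxeterSystem.IsRightDescent at h
    simp at this
    omega
  have h1 := signedAction_wordProd cs ω (cs.simple i) 0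
  rw [hw, map_mul, Equiv.Perm.mul_apply, hs] at h1
  simp only [signedConj, Equiv.coe_fn_mk] at h1
  rw [signedAction_wordProd, List.count_eq_zero_of_not_mem] at h1
  · have h2 := congrArg Prod.snd h1
    by_contra hc
    rw [List.count_eq_zero_of_not_mem hc] at h2
    simp at h2
  · simpa [mul_assoc] using hnot

/-- The exchange property on the right. -/
theorem exists_mul_simple_eq_eraseIdx (ω : List B) {i : B}
    (h : cs.IsRightDescent (cs.wordProd ω) i) :
    ∃ j < ω.length, cs.wordProd ω * cs.simple i = cs.wordProd (ω.eraseIdx j) := by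
  obtain ⟨j, hj, hji⟩ := List.mem_iff_getElem.mp (simple_mem_rightInvSeq cs ω h)
  refine ⟨j, by simpa using hj, ?_⟩
  rw [← cs.wordProd_mul_getD_rightInvSeq, List.getD_eq_getElem _ _ hj, hji]

theorem exists_sublist_mul_simple (ω : List B) {i : B}
    (h : cs.IsRightDescent (cs.wordProd ω) i) :
    ∃ ω', List.Sublist ω' ω ∧ ω'.length + 1 = ω.length ∧
      cs.wordProd ω * cs.simple i = cs.wordProd ω' := by
  obtain ⟨j, hj, hji⟩ := exists_mul_simple_eq_eraseIdx cs ω h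
  exact ⟨ω.eraseIdx j, List.eraseIdx_sublist _ _, List.length_eraseIdx_add_one hj, hji⟩

theorem exists_sublist_simple_mul (ω : List B) {i : B}
    (h : cs.IsLeftDescent (cs.wordProd ω) i) :
    ∃ ω', List.Sublist ω' ω ∧ ω'.length + 1 = ω.length ∧
      cs.simple i * cs.wordProd ω = cs.wordProd ω' := by
  rw [← cs.isRightDescent_inv_iff, ← cs.wordProd_reverse] at h
  obtain ⟨ω', h1, h2, h3⟩ := exists_sublist_mul_simple cs _ h
  refine ⟨ω'.reverse, by simpa using h1.reverse, by simpa using h2, ?_⟩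
  rw [cs.wordProd_reverse, ← h3]
  simp

/-- The deletion property. -/
theorem exists_isReduced_sublist (ω : List B) :
    ∃ ω', List.Sublist ω' ω ∧ cs.IsReduced ω' ∧ cs.wordProd ω' = cs.wordProd ω := by
  induction ω with
  | nil => exact ⟨[], List.Sublist.refl _, by simp [CoxeterSystem.IsReduced], rfl⟩
  | cons i ω ih =>
    obtain ⟨ω₁, h1, h2, h3⟩ := ih
    rcases cs.length_simple_mul (cs.wordProd ω₁) i with h | h
    · refine ⟨i :: ω₁, h1.cons_cons i, ?_, ?_⟩
      · rw [CoxeterSystem.IsReduced, cs.wordProd_cons, h, h2.eq]; simp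
      · rw [cs.wordProd_cons, cs.wordProd_cons, h3]
    · obtain ⟨ω', h4, h5, h6⟩ := exists_sublist_simple_mul cs ω₁ (i := i)
        (by unfold CoxeterSystem.IsLeftDescent; omega)
      refine ⟨ω', (h4.trans h1).cons i, ?_, ?_⟩
      · rw [CoxeterSystem.IsReduced, ← h6]
        have := h2.eq
        omega
      · rw [← h6, cs.wordProd_cons, h3]

end Exchange

/-! ### Standard parabolic subgroups. -/

section Parabolic

variable {B W : Type*} [Group W] {M : CoxeterMatrix B} {cs : CoxeterSystem M W}

theorem simple_mem_parabolic {J : Set B} {i : B} (hi : i ∈ J) : cs.simple i ∈ parabolic cs J :=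
  Subgroup.subset_closure ⟨i, hi, rfl⟩

theorem wordProd_mem_parabolic {J : Set B} {ω : List B} (h : ∀ i ∈ ω, i ∈ J) :
    cs.wordProd ω ∈ parabolic cs J := by
  induction ω with
  | nil => simp
  | cons i ω ih =>
    rw [cs.wordProd_cons]
    exact mul_mem (simple_mem_parabolic (h i (by simp))) (ih fun j hj => h j (by simp [hj]))

theorem exists_word_of_mem_parabolic {J : Set B} {w : W} (hw : w ∈ parabolic cs J) :
    ∃ ω : List B, (∀ i ∈ ω, i ∈ J) ∧ cs.wordProd ω = w := by
  induction hw using Subgroup.closure_induction with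
  | mem x hx =>
    obtain ⟨i, hi, rfl⟩ := hx
    exact ⟨[i], by simpa using hi, by simp⟩
  | one => exact ⟨[], by simp, by simp⟩
  | mul x y _ _ hx hy =>
    obtain ⟨ω, h1, rfl⟩ := hx
    obtain ⟨ω', h2, rfl⟩ := hy
    refine ⟨ω ++ ω', ?_, cs.wordProd_append _ _⟩
    intro i hi
    rcases List.mem_append.1 hi with h | h
    exacts [h1 i h, h2 i h]
  | inv x _ hx =>
    obtain ⟨ω, h1, rfl⟩ := hx
    exact ⟨ω.reverse, by simpa using h1, by simp⟩

theorem exists_isReduced_of_mem_parabolic {J : Set B} {w : W} (hw : w ∈ parabolic cs J) :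
    ∃ ω : List B, (∀ i ∈ ω, i ∈ J) ∧ cs.IsReduced ω ∧ cs.wordProd ω = w := by
  obtain ⟨ω, h1, rfl⟩ := exists_word_of_mem_parabolic hw
  obtain ⟨ω', h2, h3, h4⟩ := exists_isReduced_sublist cs ω
  exact ⟨ω', fun i hi => h1 i (h2.subset hi), h3, h4⟩

/-- Exchange in a word over J deletes one letter, so s_i w is still in W_J. -/
theorem simple_mem_parabolic_of_isLeftDescent {J : Set B} {w : W} (hw : w ∈ parabolic cs J) {i : B}
    (hi : cs.IsLeftDescent w i) : cs.simple i ∈ parabolic cs J := by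
  obtain ⟨ω, h1, rfl⟩ := exists_word_of_mem_parabolic hw
  obtain ⟨ω', h2, -, h3⟩ := exists_sublist_simple_mul cs ω hi
  have h4 : cs.wordProd ω' ∈ parabolic cs J :=
    wordProd_mem_parabolic fun i hi => h1 i (h2.subset hi)
  rw [← h3] at h4
  exact (Subgroup.mul_mem_cancel_right _ hw).1 h4

theorem exists_eq_simple_of_mem_parabolic {J : Set B} {w : W} (hw : w ∈ parabolic cs J)
    (h : cs.length w = 1) : ∃ j ∈ J, w = cs.simple j := by
  obtain ⟨ω, h1, h2, rfl⟩ := exists_isReduced_of_mem_parabolic hw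
  rw [h2.eq] at h
  obtain ⟨j, rfl⟩ := List.length_eq_one_iff.1 h
  exact ⟨j, h1 j (by simp), by simp⟩

theorem exists_isLeftDescent_of_mem_parabolic {J : Set B} {w : W} (hw : w ∈ parabolic cs J)
    (h : w ≠ 1) : ∃ j ∈ J, cs.IsLeftDescent w j := by
  obtain ⟨ω, h1, h2, rfl⟩ := exists_isReduced_of_mem_parabolic hw
  cases ω with
  | nil => simp at h
  | cons j ω =>
    refine ⟨j, h1 j (by simp), ?_⟩
    rw [CoxeterSystem.IsLeftDescent, h2.eq, cs.wordProd_cons, cs.simple_mul_simple_cancel_left]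
    have := cs.length_wordProd_le ω
    simp
    omega

@[simp] theorem parabolic_empty : parabolic cs ∅ = ⊥ := by
  simp [parabolic]

@[simp] theorem parabolic_univ : parabolic cs Set.univ = ⊤ := by
  simp [parabolic, cs.subgroup_closure_range_simple]

end Parabolic

/-! ### The Bruhat order and minimal double coset representatives. -/

section Bruhat

variable {B W : Type*} [Group W] {M : CoxeterMatrix B} {cs : CoxeterSystem M W}

/-- Together with its left-handed twin, the source of all Bruhat inequalities below: additive
lengths make the concatenation of reduced words reduced. -/
theorem bruhatLE_mul_right {u v : W} (h : cs.length (u * v) = cs.length u + cs.length v) :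
    BruhatLE cs u (u * v) := by
  obtain ⟨ω, h1, rfl⟩ := cs.exists_isReduced u
  obtain ⟨ω', h2, rfl⟩ := cs.exists_isReduced v
  refine ⟨ω ++ ω', ω, ?_, cs.wordProd_append _ _, h1, rfl, List.sublist_append_left _ _⟩
  rw [CoxeterSystem.IsReduced, cs.wordProd_append, h, h1.eq, h2.eq, List.length_append]

theorem bruhatLE_mul_left {u v : W} (h : cs.length (u * v) = cs.length u + cs.length v) :
    BruhatLE cs v (u * v) := by
  obtain ⟨ω, h1, rfl⟩ := cs.exists_isReduced u
  obtain ⟨ω', h2, rfl⟩ := cs.exists_isReduced v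
  refine ⟨ω ++ ω', ω', ?_, cs.wordProd_append _ _, h2, rfl, List.sublist_append_right _ _⟩
  rw [CoxeterSystem.IsReduced, cs.wordProd_append, h, h1.eq, h2.eq, List.length_append]

theorem BruhatLE.length_le {u v : W} (h : BruhatLE cs u v) : cs.length u ≤ cs.length v := by
  obtain ⟨ω, ω', h1, rfl, h2, rfl, h3⟩ := h
  rw [h1.eq, h2.eq]
  exact h3.length_le

theorem BruhatLE.eq_of_length_le {u v : W} (h : BruhatLE cs u v)
    (hl : cs.length v ≤ cs.length u) : u = v := by
  obtain ⟨ω, ω', h1, rfl, h2, rfl, h3⟩ := h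
  rw [h1.eq, h2.eq] at hl
  rw [h3.eq_of_length_le hl]

theorem BruhatLE.antisymm {u v : W} (h : BruhatLE cs u v) (h' : BruhatLE cs v u) : u = v :=
  h.eq_of_length_le h'.length_le

theorem bruhatLE_one (v : W) : BruhatLE cs 1 v := by
  simpa using bruhatLE_mul_right (cs := cs) (u := 1) (v := v) (by simp)

theorem bruhatLE_refl (v : W) : BruhatLE cs v v := by
  simpa using bruhatLE_mul_right (cs := cs) (u := v) (v := 1) (by simp)

theorem BruhatLE.inv {u v : W} (h : BruhatLE cs u v) : BruhatLE cs u⁻¹ v⁻¹ := by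
  obtain ⟨ω, ω', h1, rfl, h2, rfl, h3⟩ := h
  exact ⟨ω.reverse, ω'.reverse, h1.reverse, by simp, h2.reverse, by simp, h3.reverse⟩

theorem bruhatLE_inv_iff {u v : W} : BruhatLE cs u⁻¹ v⁻¹ ↔ BruhatLE cs u v :=
  ⟨fun h => by simpa using h.inv, BruhatLE.inv⟩

theorem mem_doubleCoset_inv_iff {I J : Set B} {w v : W} :
    v⁻¹ ∈ doubleCoset cs J I w⁻¹ ↔ v ∈ doubleCoset cs I J w := by
  have key : ∀ {I J : Set B} {w v : W},
      v ∈ doubleCoset cs I J w → v⁻¹ ∈ doubleCoset cs J I w⁻¹ := by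
    rintro I J w v ⟨a, ha, b, hb, rfl⟩
    exact ⟨b⁻¹, inv_mem hb, a⁻¹, inv_mem ha, by group⟩
  exact ⟨fun h => by simpa using key h, key⟩

theorem isMinRep_inv_iff {I J : Set B} {w m : W} :
    IsMinRep cs J I w⁻¹ m⁻¹ ↔ IsMinRep cs I J w m := by
  refine and_congr mem_doubleCoset_inv_iff ⟨fun h v hv => ?_, fun h v hv => ?_⟩
  · exact bruhatLE_inv_iff.1 (h v⁻¹ (mem_doubleCoset_inv_iff.2 hv))
  · rw [← inv_inv v]
    exact (h v⁻¹ (mem_doubleCoset_inv_iff.1 (by simpa using hv))).inv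

theorem IsMinRep.iff_eq {I J : Set B} {w m₀ m : W} (h : IsMinRep cs I J w m₀) :
    IsMinRep cs I J w m ↔ m = m₀ :=
  ⟨fun h' => (h'.2 _ h.1).antisymm (h.2 _ h'.1), fun h' => h' ▸ h⟩

theorem mem_minReps_inv_iff {I J : Set B} {w : W} :
    w⁻¹ ∈ minReps cs J I ↔ w ∈ minReps cs I J := by
  refine ⟨fun h v hv => ?_, fun h v hv => ?_⟩
  · exact bruhatLE_inv_iff.1 (h v⁻¹ (mem_doubleCoset_inv_iff.2 hv))
  · rw [← inv_inv v]
    exact (h v⁻¹ (mem_doubleCoset_inv_iff.1 (by simpa using hv))).inv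

end Bruhat

/-! ### Minimal coset representatives. -/

section Coset

variable {B W : Type*} [Group W] {M : CoxeterMatrix B} {cs : CoxeterSystem M W}

/-- Build v letter by letter. If the length dropped at some letter, exchange would delete a letter
from the word of x, giving a shorter element of xW_J, or from the word of v, which is reduced; both
are impossible. -/
theorem length_mul_of_forall_length_le {J : Set B} {x : W}
    (h : ∀ v ∈ parabolic cs J, cs.length x ≤ cs.length (x * v)) :
    ∀ v ∈ parabolic cs J, cs.length (x * v) = cs.length x + cs.length v := by
  intro v hv
  obtain ⟨ω, h1, h2, rfl⟩ := exists_isReduced_of_mem_parabolic hv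
  clear hv
  induction ω using List.reverseRecOn with
  | nil => simp
  | append_singleton ω i ih =>
    have hω : cs.IsReduced ω := by
      have := h2.take ω.length
      simpa using this
    have hωJ : ∀ j ∈ ω, j ∈ J := fun j hj => h1 j (by simp [hj])
    have hiJ : i ∈ J := h1 i (by simp)
    have ih' := ih hωJ hω
    rw [h2.eq]
    rw [hω.eq] at ih'
    rw [cs.wordProd_append, cs.wordProd_singleton, ← mul_assoc]
    rcases cs.length_mul_simple (x * cs.wordProd ω) i with hl | hl
    · rw [hl, ih']; simp [add_assoc]
    exfalso
    obtain ⟨τ, hτ, rfl⟩ := cs.exists_isReduced x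
    obtain ⟨ω', h3, h4, h5⟩ := exists_sublist_mul_simple cs (τ ++ ω) (i := i)
      (by rw [cs.wordProd_append]; unfold CoxeterSystem.IsRightDescent; omega)
    obtain ⟨a, b, rfl, ha, hb⟩ := List.sublist_append_iff.1 h3
    rw [cs.wordProd_append, cs.wordProd_append] at h5
    have la := ha.length_le
    have lb := hb.length_le
    simp only [List.length_append] at h4
    rcases Nat.lt_or_ge a.length τ.length with hlt | hge
    -- The letter is deleted from x: conjugating s_i by the rest of v exhibits the shorter word `a`
    -- as an element of xW_J.
    · have hbe : b = ω := hb.eq_of_length_le (by omega)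
      subst hbe
      have hmem : cs.wordProd b * cs.simple i * (cs.wordProd b)⁻¹ ∈ parabolic cs J :=
        mul_mem (mul_mem (wordProd_mem_parabolic hωJ) (simple_mem_parabolic hiJ))
          (inv_mem (wordProd_mem_parabolic hωJ))
      have h6 := h _ hmem
      rw [← mul_assoc, ← mul_assoc, h5, mul_inv_cancel_right, hτ.eq] at h6
      have := cs.length_wordProd_le a
      omega
    · have hae : a = τ := ha.eq_of_length_le hge
      subst hae
      rw [mul_assoc] at h5
      have h6 := mul_left_cancel h5
      have h7 := h2.eq
      rw [cs.wordProd_append, cs.wordProd_singleton, h6] at h7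
      have := cs.length_wordProd_le b
      simp at h7
      omega

/-- `x` is the element of minimum length of `x W_J`. -/
def CosetMin (cs : CoxeterSystem M W) (J : Set B) (x : W) : Prop :=
  ∀ v ∈ parabolic cs J, cs.length (x * v) = cs.length x + cs.length v

theorem cosetMin_one {J : Set B} : CosetMin cs J 1 := fun v _ => by simp

theorem CosetMin.eq_one {J : Set B} {x v : W} (hx : CosetMin cs J x) (hv : v ∈ parabolic cs J)
    (hxv : CosetMin cs J (x * v)) : v = 1 := by
  have h1 := hx v hv
  have h2 := hxv v⁻¹ (inv_mem hv)
  rw [mul_inv_cancel_right, cs.length_inv] at h2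
  exact cs.length_eq_zero_iff.1 (by omega)

theorem CosetMin.unique {J : Set B} {x x' : W} (hx : CosetMin cs J x) (hx' : CosetMin cs J x')
    (h : x⁻¹ * x' ∈ parabolic cs J) : x = x' := by
  have h1 := hx.eq_one h (by simpa using hx')
  exact (inv_mul_eq_one.1 h1)

theorem exists_cosetMin (J : Set B) (w : W) :
    ∃ x v : W, CosetMin cs J x ∧ v ∈ parabolic cs J ∧ w = x * v := by
  obtain ⟨v, hv, hmin⟩ : ∃ v ∈ parabolic cs J, ∀ u ∈ parabolic cs J,
      cs.length (w * v) ≤ cs.length (w * u) := by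
    -- W may be infinite here, so the minimum is taken over lengths.
    have hne : {n | ∃ v ∈ parabolic cs J, n = cs.length (w * v)}.Nonempty := ⟨_, 1, one_mem _, rfl⟩
    obtain ⟨v, hv, hn⟩ := Nat.sInf_mem hne
    exact ⟨v, hv, fun u hu => hn ▸ Nat.sInf_le ⟨u, hu, rfl⟩⟩
  refine ⟨w * v, v⁻¹, length_mul_of_forall_length_le fun u hu => ?_, inv_mem hv, by group⟩
  rw [mul_assoc]
  exact hmin _ (mul_mem hv hu)

theorem mem_minReps_empty_left_iff {J : Set B} {x : W} :
    x ∈ minReps cs ∅ J ↔ CosetMin cs J x := by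
  constructor
  · intro h
    refine length_mul_of_forall_length_le fun v hv => ?_
    exact (h _ ⟨1, one_mem _, v, hv, by simp⟩).length_le
  · rintro h v ⟨a, ha, b, hb, rfl⟩
    rw [parabolic_empty, Subgroup.mem_bot] at ha
    subst ha
    rw [one_mul]
    exact bruhatLE_mul_right (h b hb)

theorem mem_minReps_empty_right_iff {J : Set B} {x : W} :
    x ∈ minReps cs J ∅ ↔ CosetMin cs J x⁻¹ := by
  rw [← mem_minReps_empty_left_iff, mem_minReps_inv_iff]

end Coset

/-! ### Longest elements, and w₀ as a length-reversing map. -/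

section Longest

variable {B W : Type*} [Group W] {M : CoxeterMatrix B} {cs : CoxeterSystem M W}

/-- `w` is an element of maximum length of `W_J`. -/
structure IsLongest (cs : CoxeterSystem M W) (J : Set B) (w : W) : Prop where
  mem : w ∈ parabolic cs J
  length_le : ∀ v ∈ parabolic cs J, cs.length v ≤ cs.length w

theorem exists_isLongest [Finite W] (cs : CoxeterSystem M W) (J : Set B) :
    ∃ w, IsLongest cs J w := by
  obtain ⟨⟨w, hw⟩, h⟩ := Finite.exists_max fun v : parabolic cs J => cs.length v
  exact ⟨w, hw, fun v hv => h ⟨v, hv⟩⟩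

theorem isLongest_longest [Finite W] (cs : CoxeterSystem M W) :
    IsLongest cs Set.univ (longest cs) :=
  ⟨by simp, fun v _ => length_le_length_longest cs v⟩

namespace IsLongest

variable {J : Set B} {w : W}

/-- Every reduced word over J is a prefix of some reduced word of w. Inductively, s_i is a left
descent of w by maximality, and exchange cannot delete inside the prefix ω because i :: ω is
reduced. -/
theorem length_mul_add (hw : IsLongest cs J w) {v : W} (hv : v ∈ parabolic cs J) :
    cs.length (v * w) + cs.length v = cs.length w := by
  suffices h : ∀ ω : List B, (∀ i ∈ ω, i ∈ J) → cs.IsReduced ω →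
      ∃ u, w = cs.wordProd ω * u ∧ cs.length w = ω.length + cs.length u by
    -- The prefix is taken to be v⁻¹: from w = v⁻¹u one gets vw = u.
    obtain ⟨ω, h1, h2, h3⟩ := exists_isReduced_of_mem_parabolic (inv_mem hv)
    obtain ⟨u, h4, h5⟩ := h ω h1 h2
    rw [h5, h4, h3, ← mul_assoc, mul_inv_cancel, one_mul, add_comm, ← h2.eq, h3, cs.length_inv]
  intro ω
  induction ω with
  | nil => exact fun _ _ => ⟨w, by simp, by simp⟩
  | cons i ω ih =>
    intro h1 h2
    have hω : cs.IsReduced ω := h2.drop 1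
    obtain ⟨u, h3, h4⟩ := ih (fun j hj => h1 j (by simp [hj])) hω
    obtain ⟨τ, hτ, rfl⟩ := cs.exists_isReduced u
    have hd : cs.IsLeftDescent (cs.wordProd (ω ++ τ)) i := by
      rw [cs.wordProd_append, ← h3, CoxeterSystem.IsLeftDescent]
      exact lt_of_le_of_ne
        (hw.length_le _ (mul_mem (simple_mem_parabolic (h1 i (by simp))) hw.mem))
        (cs.length_simple_mul_ne _ _)
    obtain ⟨ω', h5, h6, h7⟩ := exists_sublist_simple_mul cs _ hd
    obtain ⟨a, b, rfl, ha, hb⟩ := List.sublist_append_iff.1 h5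
    rw [cs.wordProd_append, cs.wordProd_append] at h7
    have la := ha.length_le
    have lb := hb.length_le
    simp only [List.length_append] at h6
    rcases Nat.lt_or_ge a.length ω.length with hlt | hge
    · have hbe : b = τ := hb.eq_of_length_le (by omega)
      subst hbe
      rw [← mul_assoc] at h7
      have h8 := mul_right_cancel h7
      have h9 := h2.eq
      rw [cs.wordProd_cons, h8] at h9
      have := cs.length_wordProd_le a
      simp at h9
      omega
    · have hae : a = ω := ha.eq_of_length_le hge
      subst hae
      have h8 : w = cs.wordProd (i :: a) * cs.wordProd b := by
        rw [cs.wordProd_cons, mul_assoc, ← h7, ← h3, cs.simple_mul_simple_cancel_left]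
      refine ⟨_, h8, ?_⟩
      have h9 := cs.length_mul_le (cs.wordProd (i :: a)) (cs.wordProd b)
      rw [← h8, h2.eq] at h9
      have h10 := cs.length_wordProd_le b
      rw [hτ.eq] at h4
      simp only [List.length_cons] at h9 ⊢
      omega

theorem mul_self (hw : IsLongest cs J w) : w * w = 1 := by
  have := hw.length_mul_add hw.mem
  exact cs.length_eq_zero_iff.1 (by omega)

theorem inv_eq (hw : IsLongest cs J w) : w⁻¹ = w := inv_eq_of_mul_eq_one_left hw.mul_self

theorem length_mul_add' (hw : IsLongest cs J w) {v : W} (hv : v ∈ parabolic cs J) :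
    cs.length (w * v) + cs.length v = cs.length w := by
  have := hw.length_mul_add (inv_mem hv)
  rwa [← cs.length_inv, mul_inv_rev, inv_inv, hw.inv_eq, cs.length_inv] at this

theorem eq_of_length_le (hw : IsLongest cs J w) {v : W} (hv : v ∈ parabolic cs J)
    (h : cs.length w ≤ cs.length v) : v = w := by
  have := hw.length_mul_add hv
  have h1 : v * w = 1 := cs.length_eq_zero_iff.1 (by omega)
  rw [mul_eq_one_iff_eq_inv, hw.inv_eq] at h1
  exact h1

end IsLongest

variable [Finite W]

theorem longest_mul_self : longest cs * longest cs = 1 := (isLongest_longest cs).mul_self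

theorem longest_mul_cancel_left (w : W) : longest cs * (longest cs * w) = w := by
  rw [← mul_assoc, longest_mul_self, one_mul]

theorem longest_inv : (longest cs)⁻¹ = longest cs := (isLongest_longest cs).inv_eq

theorem length_mul_longest_add (v : W) :
    cs.length (v * longest cs) + cs.length v = cs.length (longest cs) :=
  (isLongest_longest cs).length_mul_add (by simp)

theorem length_longest_mul_add (v : W) :
    cs.length (longest cs * v) + cs.length v = cs.length (longest cs) :=
  (isLongest_longest cs).length_mul_add' (by simp)

/-- Multiplication by w₀ on either side complements lengths, so conjugation by w₀ preserves them. -/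
theorem exists_longest_conj_simple (i : B) :
    ∃ j, longest cs * cs.simple i * longest cs = cs.simple j := by
  refine cs.length_eq_one_iff.1 ?_
  have h1 := length_mul_longest_add (cs := cs) (longest cs * cs.simple i)
  have h2 := length_longest_mul_add (cs := cs) (cs.simple i)
  rw [cs.length_simple] at h2
  omega

theorem longest_conj_mem_parabolic {J J' : Set B}
    (h : ∀ i ∈ J, ∃ j ∈ J', longest cs * cs.simple i * longest cs = cs.simple j) {w : W}
    (hw : w ∈ parabolic cs J) : longest cs * w * longest cs ∈ parabolic cs J' := by
  induction hw using Subgroup.closure_induction with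
  | mem x hx =>
    obtain ⟨i, hi, rfl⟩ := hx
    obtain ⟨j, hj, h⟩ := h i hi
    rw [h]
    exact simple_mem_parabolic hj
  | one => simp [longest_mul_self]
  | mul x y _ _ hx hy =>
    have := mul_mem hx hy
    simpa only [mul_assoc, longest_mul_cancel_left] using this
  | inv x _ hx =>
    have := inv_mem hx
    simpa [mul_assoc, longest_inv] using this

variable {J J' : Set B}

/-- Left multiplication by w₀ reverses lengths, so it carries the longest element of W_J to the
shortest element of w₀W_J. -/
theorem IsLongest.longest_mul {w : W} (hw : IsLongest cs J w) : CosetMin cs J (longest cs * w) := by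
  intro v hv
  have h1 := length_longest_mul_add (cs := cs) w
  have h2 := length_longest_mul_add (cs := cs) (w * v)
  have h3 := hw.length_mul_add' hv
  rw [mul_assoc]
  omega

/-- As W_{J'} = w₀W_Jw₀, the double coset W_{J'}w₀W_J collapses to the single coset w₀W_J. -/
theorem isMinRep_longest_mul (h : ∀ v, v ∈ parabolic cs J' ↔
    longest cs * v * longest cs ∈ parabolic cs J) {w : W} (hw : IsLongest cs J w) :
    IsMinRep cs J' J (longest cs) (longest cs * w) := by
  refine ⟨⟨1, one_mem _, w, hw.mem, by simp⟩, ?_⟩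
  rintro _ ⟨a, ha, b, hb, rfl⟩
  have h1 : a * longest cs * b =
      longest cs * w * (w * (longest cs * a * longest cs) * b) := by
    have : w * (w * (longest cs * a * longest cs) * b) = longest cs * a * longest cs * b := by
      rw [← mul_assoc, ← mul_assoc, hw.mul_self, one_mul]
    rw [mul_assoc (longest cs) w, this]
    simp only [mul_assoc, longest_mul_cancel_left]
  rw [h1]
  exact bruhatLE_mul_right
    (hw.longest_mul _ (mul_mem (mul_mem hw.mem ((h a).1 ha)) hb))

theorem isMinRep_mul_longest (h : ∀ v, v ∈ parabolic cs J' ↔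
    longest cs * v * longest cs ∈ parabolic cs J) {w : W} (hw : IsLongest cs J w) :
    IsMinRep cs J J' (longest cs) (w * longest cs) := by
  rw [← isMinRep_inv_iff, mul_inv_rev, longest_inv, hw.inv_eq]
  exact isMinRep_longest_mul h hw

/-- x w is the longest element of xW_J. Right multiplication by w₀ reverses lengths and sends xW_J
to a left coset of W_{J'}. This passes between x₀ and σ₋. -/
theorem CosetMin.mul_longest (h : ∀ v, v ∈ parabolic cs J' ↔
    longest cs * v * longest cs ∈ parabolic cs J) {w x : W} (hw : IsLongest cs J w)
    (hx : CosetMin cs J x) : CosetMin cs J' (x * w * longest cs) := by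
  intro v hv
  have hv' := (h v).1 hv
  have e : x * w * longest cs * v = x * (w * (longest cs * v * longest cs)) * longest cs := by
    simp only [mul_assoc, longest_mul_self, mul_one]
  have h1 := length_mul_longest_add (cs := cs) (x * (w * (longest cs * v * longest cs)))
  have h2 := length_mul_longest_add (cs := cs) (x * w)
  have h3 := hx _ hw.mem
  have h4 := hx _ (mul_mem hw.mem hv')
  have h5 := hw.length_mul_add' hv'
  have h6 := length_mul_longest_add (cs := cs) (longest cs * v)
  have h7 := length_longest_mul_add (cs := cs) v
  rw [e]
  omega

/-- Makes w₀w the Bruhat maximum of W^J: lengths add in w₀w = (w₀wx⁻¹)x, since wx⁻¹ is the inverse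
of xw. -/
theorem CosetMin.bruhatLE_longest_mul {w x : W} (hw : IsLongest cs J w) (hx : CosetMin cs J x) :
    BruhatLE cs x (longest cs * w) := by
  have h1 := length_mul_longest_add (cs := cs) (x * w)
  have h2 := hx _ hw.mem
  have h3 := length_longest_mul_add (cs := cs) w
  have e : longest cs * w = longest cs * (w * x⁻¹) * x := by group
  rw [e]
  refine bruhatLE_mul_left ?_
  rw [← e]
  have h4 := length_longest_mul_add (cs := cs) (w * x⁻¹)
  have h5 : cs.length (w * x⁻¹) = cs.length (x * w) := by
    rw [← cs.length_inv, mul_inv_rev, inv_inv, hw.inv_eq]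
  omega

theorem bruhatLE_mul_longest_of_cosetMin_inv {w y : W} (hw : IsLongest cs J w)
    (hy : CosetMin cs J y⁻¹) : BruhatLE cs y (w * longest cs) := by
  rw [← bruhatLE_inv_iff, mul_inv_rev, longest_inv, hw.inv_eq]
  exact hy.bruhatLE_longest_mul hw

end Longest

/-! ### Parabolic subgroups that are direct products. -/

section Product

variable {B W : Type*} [Group W] {M : CoxeterMatrix B} {cs : CoxeterSystem M W}

/-- Since s_i is minimal in s_iW_J, lengths add there, which forces s_i s_j s_i to have length 1. It
is then a simple reflection of W_J lying in W_{i,j}, hence s_j because s_i is not in W_J. -/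
theorem commute_simple_of_normalizes {J : Set B} {i : B} (hi : cs.simple i ∉ parabolic cs J)
    (hn : ∀ v ∈ parabolic cs J, cs.simple i * v * cs.simple i ∈ parabolic cs J) {j : B}
    (hj : j ∈ J) : Commute (cs.simple i) (cs.simple j) := by
  have hmin : CosetMin cs J (cs.simple i) := by
    refine length_mul_of_forall_length_le fun v hv => ?_
    rw [cs.length_simple, Nat.one_le_iff_ne_zero, Ne, cs.length_eq_zero_iff]
    intro h
    exact hi (by rw [eq_inv_of_mul_eq_one_left h]; exact inv_mem hv)
  have hjm := simple_mem_parabolic (cs := cs) hj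
  have h1 := hmin _ hjm
  have h2 := hn _ hjm
  have h3 := hmin _ (inv_mem h2)
  have e1 : cs.simple i * (cs.simple i * cs.simple j * cs.simple i)⁻¹ =
      cs.simple j * cs.simple i := by simp [mul_assoc]
  have e2 : cs.length (cs.simple j * cs.simple i) = cs.length (cs.simple i * cs.simple j) := by
    rw [← cs.length_inv]; simp
  rw [e1, e2, h1, cs.length_inv, cs.length_simple, cs.length_simple] at h3
  obtain ⟨k, hk, hk'⟩ := exists_eq_simple_of_mem_parabolic h2 (by omega)
  have e3 : cs.simple k * cs.simple i = cs.simple i * cs.simple j := by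
    rw [← hk']; simp
  have hpair : cs.simple k ∈ parabolic cs ({i, j} : Set B) := by
    rw [← hk']
    have hi' : cs.simple i ∈ parabolic cs ({i, j} : Set B) := simple_mem_parabolic (by simp)
    exact mul_mem (mul_mem hi' (simple_mem_parabolic (by simp))) hi'
  obtain ⟨l, hl, hkl⟩ := exists_eq_simple_of_mem_parabolic hpair (cs.length_simple k)
  rcases hl with rfl | rfl
  · exact absurd (hkl ▸ simple_mem_parabolic hk) hi
  · rw [hkl] at e3
    exact e3.symm

variable {I J : Set B}

theorem commute_of_commute_simple
    (h : ∀ i ∈ I, ∀ j ∈ J, Commute (cs.simple i) (cs.simple j)) {d n : W}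
    (hd : d ∈ parabolic cs I) (hn : n ∈ parabolic cs J) : Commute d n := by
  induction hd using Subgroup.closure_induction with
  | mem x hx =>
    obtain ⟨i, hi, rfl⟩ := hx
    induction hn using Subgroup.closure_induction with
    | mem y hy =>
      obtain ⟨j, hj, rfl⟩ := hy
      exact h i hi j hj
    | one => exact Commute.one_right _
    | mul x y _ _ hx hy => exact hx.mul_right hy
    | inv x _ hx => exact hx.inv_right
  | one => exact Commute.one_left _
  | mul x y _ _ hx hy => exact hx.mul_left hy
  | inv x _ hx => exact hx.inv_left

theorem parabolic_mono (h : I ⊆ J) : parabolic cs I ≤ parabolic cs J :=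
  Subgroup.closure_mono (Set.image_mono h)

theorem mul_mem_parabolic_union {d n : W} (hd : d ∈ parabolic cs I) (hn : n ∈ parabolic cs J) :
    d * n ∈ parabolic cs (I ∪ J) :=
  mul_mem (parabolic_mono Set.subset_union_left hd) (parabolic_mono Set.subset_union_right hn)

/-- The parabolic subgroup `W_{I ∪ J}` is the direct product of `W_I` and `W_J`. -/
structure IsProductPair (cs : CoxeterSystem M W) (I J : Set B) : Prop where
  commute : ∀ d ∈ parabolic cs I, ∀ n ∈ parabolic cs J, Commute d n
  eq_one : ∀ w ∈ parabolic cs I, w ∈ parabolic cs J → w = 1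

namespace IsProductPair

variable (h : IsProductPair cs I J)
include h

theorem eq_and_eq {d d' n n' : W} (hd : d ∈ parabolic cs I) (hd' : d' ∈ parabolic cs I)
    (hn : n ∈ parabolic cs J) (hn' : n' ∈ parabolic cs J) (he : d * n = d' * n') :
    d = d' ∧ n = n' := by
  have h1 : d'⁻¹ * d = n' * n⁻¹ := by
    rw [inv_mul_eq_iff_eq_mul, ← mul_assoc, ← he, mul_inv_cancel_right]
  have h2 := h.eq_one _ (mul_mem (inv_mem hd') hd) (h1 ▸ mul_mem hn' (inv_mem hn))
  rw [inv_mul_eq_one] at h2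
  subst h2
  exact ⟨rfl, mul_left_cancel he⟩

/-- Sorting the letters of ω into the two factors. The length bound, applied to a reduced word,
yields additivity of length in `length_mul`. -/
theorem exists_word (ω : List B) (hω : ∀ i ∈ ω, i ∈ I ∪ J) :
    ∃ d ∈ parabolic cs I, ∃ n ∈ parabolic cs J, cs.wordProd ω = d * n ∧
      cs.length d + cs.length n ≤ ω.length := by
  induction ω with
  | nil => exact ⟨1, one_mem _, 1, one_mem _, by simp, by simp⟩
  | cons i ω ih =>
    obtain ⟨d, hd, n, hn, h1, h2⟩ := ih fun j hj => hω j (by simp [hj])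
    rw [cs.wordProd_cons, h1, List.length_cons]
    rcases hω i (by simp) with hi | hi
    · have h3 := cs.length_mul_le (cs.simple i) d
      rw [cs.length_simple] at h3
      exact ⟨cs.simple i * d, mul_mem (simple_mem_parabolic hi) hd, n, hn, by group, by omega⟩
    · have h3 := cs.length_mul_le (cs.simple i) n
      rw [cs.length_simple] at h3
      refine ⟨d, hd, cs.simple i * n, mul_mem (simple_mem_parabolic hi) hn, ?_, by omega⟩
      rw [← mul_assoc, ← mul_assoc, (h.commute d hd _ (simple_mem_parabolic hi)).eq]

theorem exists_eq_mul {w : W} (hw : w ∈ parabolic cs (I ∪ J)) :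
    ∃ d ∈ parabolic cs I, ∃ n ∈ parabolic cs J, w = d * n := by
  obtain ⟨ω, h1, rfl⟩ := exists_word_of_mem_parabolic hw
  obtain ⟨d, hd, n, hn, h2, -⟩ := h.exists_word ω h1
  exact ⟨d, hd, n, hn, h2⟩

theorem length_mul {d n : W} (hd : d ∈ parabolic cs I) (hn : n ∈ parabolic cs J) :
    cs.length (d * n) = cs.length d + cs.length n := by
  refine le_antisymm (cs.length_mul_le _ _) ?_
  obtain ⟨ω, h1, h2, h3⟩ := exists_isReduced_of_mem_parabolic (mul_mem_parabolic_union hd hn)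
  obtain ⟨d', hd', n', hn', h4, h5⟩ := h.exists_word ω h1
  obtain ⟨rfl, rfl⟩ := h.eq_and_eq hd hd' hn hn' (h3.symm.trans h4)
  rw [← h3, h2.eq]
  exact h5

theorem isLongest {wI wJ : W} (hI : IsLongest cs I wI) (hJ : IsLongest cs J wJ) :
    IsLongest cs (I ∪ J) (wI * wJ) := by
  refine ⟨mul_mem_parabolic_union hI.mem hJ.mem, fun v hv => ?_⟩
  obtain ⟨d, hd, n, hn, rfl⟩ := h.exists_eq_mul hv
  rw [h.length_mul hd hn, h.length_mul hI.mem hJ.mem]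
  exact add_le_add (hI.length_le d hd) (hJ.length_le n hn)

theorem cosetMin_mul {x d : W} (hx : CosetMin cs (I ∪ J) x) (hd : d ∈ parabolic cs I) :
    CosetMin cs J (x * d) := by
  intro n hn
  rw [mul_assoc, hx _ (mul_mem_parabolic_union hd hn), h.length_mul hd hn,
    hx _ (parabolic_mono Set.subset_union_left hd), add_assoc]

/-- With `cosetMin_mul`, gives W^J = W^{I ∪ J} W_I: the W_J-component of x must vanish by
minimality. -/
theorem exists_of_cosetMin {x : W} (hx : CosetMin cs J x) :
    ∃ x₀ d : W, CosetMin cs (I ∪ J) x₀ ∧ d ∈ parabolic cs I ∧ x = x₀ * d := by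
  obtain ⟨x₀, v, h1, h2, rfl⟩ := exists_cosetMin (cs := cs) (I ∪ J) x
  obtain ⟨d, hd, n, hn, rfl⟩ := h.exists_eq_mul h2
  rw [← mul_assoc] at hx
  have := (h.cosetMin_mul h1 hd).eq_one hn hx
  subst this
  exact ⟨x₀, d, h1, hd, by simp⟩

end IsProductPair

end Product

/-! ### The type maps: W_{λ(e)} as a direct product. -/

section Maps

variable {B R : Type*} [Monoid R] {M : CoxeterMatrix B} {cs : CoxeterSystem M Rˣ} {Λ : Set R}
  (hΛ : IsRennerCoxeterSystem cs Λ) {e : R} (he : e ∈ Λ)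

theorem upperType_union_lowerType (cs : CoxeterSystem M Rˣ) (e : R) :
    upperType cs e ∪ lowerType cs e = typeMap cs e := by
  ext i
  simp only [upperType, lowerType, typeMap, Set.mem_union, Set.mem_ofPred_eq]
  constructor
  · rintro (h | h)
    · exact h.1
    · rw [h.1, h.2]
  · intro h
    by_cases h' : e * (cs.simple i : R) = e
    · exact Or.inr ⟨h.trans h', h'⟩
    · exact Or.inl ⟨h, h'⟩

include hΛ he in
-- An upper generator commutes with e, so it normalizes the fixer of e without belonging to it. A
-- nontrivial common element would have a left descent in λ^*(e), which would then lie in the fixer.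
theorem isProductPair_upperType_lowerType :
    IsProductPair cs (upperType cs e) (lowerType cs e) := by
  have hnot : ∀ i ∈ upperType cs e, cs.simple i ∉ parabolic cs (lowerType cs e) := fun i hi h =>
    hi.2 ((mem_parabolic_lowerType hΛ he _).1 h).2
  have hcomm : ∀ i ∈ upperType cs e, ∀ j ∈ lowerType cs e,
      Commute (cs.simple i) (cs.simple j) := by
    intro i hi j hj
    refine commute_simple_of_normalizes (hnot i hi) (fun v hv => ?_) hj
    obtain ⟨h1, h2⟩ := (mem_parabolic_lowerType hΛ he _).1 hv
    have hs : (cs.simple i : R) * (cs.simple i : R) = 1 := by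
      rw [← Units.val_mul, cs.simple_mul_simple_self, Units.val_one]
    have h3 : (cs.simple i : R) * e = e * (cs.simple i : R) := hi.1
    refine (mem_parabolic_lowerType hΛ he _).2 ⟨?_, ?_⟩
    · push_cast
      rw [mul_assoc, h3, mul_assoc, ← mul_assoc (v : R), h1, ← mul_assoc, h3, mul_assoc, hs,
        mul_one]
    · push_cast
      rw [← mul_assoc, ← mul_assoc, ← h3, mul_assoc (cs.simple i : R), h2, h3, mul_assoc, hs,
        mul_one]
  refine ⟨fun d hd n hn => commute_of_commute_simple hcomm hd hn, fun w hw hw' => ?_⟩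
  by_contra hne
  obtain ⟨i, hi, hd⟩ := exists_isLeftDescent_of_mem_parabolic hw hne
  exact hnot i hi (simple_mem_parabolic_of_isLeftDescent hw' hd)

end Maps

/-! ### Green's relations through divisibility. -/

section Green

variable {R : Type*} [Monoid R] {r s : R}

theorem greenL_iff : GreenL r s ↔ (∃ p, r = p * s) ∧ ∃ q, s = q * r := by
  constructor
  · intro h
    have h1 : r ∈ {x : R | ∃ a, x = a * r} := ⟨1, by simp⟩
    have h2 : s ∈ {x : R | ∃ a, x = a * s} := ⟨1, by simp⟩
    exact ⟨by rwa [h] at h1, by rwa [← h] at h2⟩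
  · rintro ⟨⟨p, hp⟩, q, hq⟩
    ext x
    constructor
    · rintro ⟨a, rfl⟩
      exact ⟨a * p, by rw [mul_assoc, ← hp]⟩
    · rintro ⟨a, rfl⟩
      exact ⟨a * q, by rw [mul_assoc, ← hq]⟩

theorem greenR_iff : GreenR r s ↔ (∃ p, r = s * p) ∧ ∃ q, s = r * q := by
  constructor
  · intro h
    have h1 : r ∈ {x : R | ∃ a, x = r * a} := ⟨1, by simp⟩
    have h2 : s ∈ {x : R | ∃ a, x = s * a} := ⟨1, by simp⟩
    exact ⟨by rwa [h] at h1, by rwa [← h] at h2⟩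
  · rintro ⟨⟨p, hp⟩, q, hq⟩
    ext x
    constructor
    · rintro ⟨a, rfl⟩
      exact ⟨p * a, by rw [← mul_assoc, ← hp]⟩
    · rintro ⟨a, rfl⟩
      exact ⟨q * a, by rw [← mul_assoc, ← hq]⟩

theorem greenJ_iff : GreenJ r s ↔ (∃ p q, r = p * s * q) ∧ ∃ p q, s = p * r * q := by
  constructor
  · intro h
    have h1 : r ∈ {x : R | ∃ a b, x = a * r * b} := ⟨1, 1, by simp⟩
    have h2 : s ∈ {x : R | ∃ a b, x = a * s * b} := ⟨1, 1, by simp⟩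
    exact ⟨by rwa [h] at h1, by rwa [← h] at h2⟩
  · rintro ⟨⟨p, q, hp⟩, p', q', hq⟩
    ext x
    constructor
    · rintro ⟨a, b, rfl⟩
      exact ⟨a * p, q * b, by rw [hp]; simp only [mul_assoc]⟩
    · rintro ⟨a, b, rfl⟩
      exact ⟨a * p', q' * b, by rw [hq]; simp only [mul_assoc]⟩

theorem greenJ_units (w v : Rˣ) (r : R) : GreenJ (w * r * v) r :=
  greenJ_iff.2 ⟨⟨w, v, rfl⟩, (w⁻¹ : Rˣ), (v⁻¹ : Rˣ), by simp [mul_assoc]⟩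

theorem GreenJ.symm (h : GreenJ r s) : GreenJ s r := Eq.symm h

theorem GreenJ.trans {t : R} (h : GreenJ r s) (h' : GreenJ s t) : GreenJ r t := Eq.trans h h'

end Green

/-! ### Idempotents of a factorizable monoid; 𝓙-equivalence and conjugacy. -/

section Idempotents

variable {R : Type*} [Monoid R]

theorem conj_mul_conj (w : Rˣ) (a b : R) :
    w * a * (w⁻¹ : Rˣ) * (w * b * (w⁻¹ : Rˣ)) = w * (a * b) * (w⁻¹ : Rˣ) := by
  simp [mul_assoc]

theorem isIdempotentElem_conj {e : R} (he : IsIdempotentElem e) (w : Rˣ) :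
    IsIdempotentElem (w * e * (w⁻¹ : Rˣ)) := by
  unfold IsIdempotentElem
  rw [conj_mul_conj, he.eq]

theorem mul_conj_pow {e : R} (he : IsIdempotentElem e) {z : Rˣ} (h : e * (z * e * (z⁻¹ : Rˣ)) = e) (n : ℕ) :
    e * ((z ^ n : Rˣ) * e * ((z ^ n)⁻¹ : Rˣ)) = e := by
  induction n with
  | zero => simpa using he.eq
  | succ n ih =>
    have h1 := conj_mul_conj (z ^ n) e (z * e * (z⁻¹ : Rˣ))
    rw [h] at h1
    have h2 : ((z ^ (n + 1) : Rˣ) : R) * e * ((z ^ (n + 1))⁻¹ : Rˣ) =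
        (z ^ n : Rˣ) * (z * e * (z⁻¹ : Rˣ)) * ((z ^ n)⁻¹ : Rˣ) := by
      simp only [pow_succ, mul_inv_rev, Units.val_mul, mul_assoc]
    rw [h2]
    nth_rw 1 [← ih]
    rw [mul_assoc, h1, ih]

variable (hR : IsFactorizable R) {e f : R} (he : IsIdempotentElem e) (hf : IsIdempotentElem f)
include hR he hf

theorem IsFactorizable.eq_of_eq_mul_unit {z : Rˣ} (h : e = f * z) : e = f := by
  have h1 : f * e = e := by rw [h, ← mul_assoc, hf.eq]
  have h2 : f = e * (z⁻¹ : Rˣ) := by rw [h]; simp [mul_assoc]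
  have h3 : e * f = f := by rw [h2, ← mul_assoc, he.eq]
  rw [← h1, ← hR.idem_comm e f he hf, h3]

/-- Write p = wg and q = kv with g, k idempotent. Then e is the idempotent w(gfk)w⁻¹ times a unit,
hence equal to it, and this lies below wfw⁻¹. -/
theorem IsFactorizable.exists_mul_conj_eq {p q : R} (h : e = p * f * q) :
    ∃ u : Rˣ, e * (u * f * (u⁻¹ : Rˣ)) = e := by
  obtain ⟨g, hg, w, rfl⟩ := hR.exists_unit_mul_idem p
  obtain ⟨k, hk, v, rfl⟩ := hR.exists_idem_mul_unit q
  have hgf : IsIdempotentElem (g * f) :=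
    IsIdempotentElem.mul_of_commute (hR.idem_comm _ _ hg hf) hg hf
  have hgfk : IsIdempotentElem (g * f * k) :=
    IsIdempotentElem.mul_of_commute (hR.idem_comm _ _ hgf hk) hgf hk
  have h0 : e = w * (g * f * k) * (w⁻¹ : Rˣ) := by
    refine hR.eq_of_eq_mul_unit (z := w * v) he (isIdempotentElem_conj hgfk w) ?_
    rw [h]
    simp [mul_assoc]
  have h1 : g * f * k * f = g * f * k := by
    rw [mul_assoc, ← hR.idem_comm f k hf hk, ← mul_assoc, mul_assoc g, hf.eq]
  refine ⟨w, ?_⟩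
  rw [h0, conj_mul_conj, h1]

/-- Divisibility both ways gives e ≤ ufu⁻¹ ≤ zez⁻¹ with z = uv. As z has finite order, iterating e ≤
zez⁻¹ returns to e, so the chain consists of equalities. -/
theorem IsFactorizable.exists_conj_eq_of_greenJ [Finite R] (h : GreenJ e f) :
    ∃ u : Rˣ, u * f * (u⁻¹ : Rˣ) = e := by
  obtain ⟨⟨p, q, h1⟩, p', q', h2⟩ := greenJ_iff.1 h
  obtain ⟨u, hu⟩ := hR.exists_mul_conj_eq he hf h1
  obtain ⟨v, hv⟩ := hR.exists_mul_conj_eq hf he h2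
  have hF := isIdempotentElem_conj hf u
  have hz := isIdempotentElem_conj he (u * v)
  set F := u * f * (u⁻¹ : Rˣ) with hFdef
  have h3 : F * ((u * v : Rˣ) * e * ((u * v)⁻¹ : Rˣ)) = F := by
    have h4 := conj_mul_conj u f (v * e * (v⁻¹ : Rˣ))
    rw [hv] at h4
    simpa only [hFdef, Units.val_mul, mul_inv_rev, mul_assoc] using h4
  have h5 : e * ((u * v : Rˣ) * e * ((u * v)⁻¹ : Rˣ)) = e := by
    calc _ = e * F * ((u * v : Rˣ) * e * ((u * v)⁻¹ : Rˣ)) := by rw [hu]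
      _ = e := by rw [mul_assoc, h3, hu]
  refine ⟨u, ?_⟩
  rw [← hFdef]
  generalize u * v = z at *
  have h6 : z * e * (z⁻¹ : Rˣ) = e := by
    -- The exponent n + 1 allows e ≤ zⁿez⁻ⁿ to be conjugated once more by z, giving zez⁻¹ ≤ e.
    obtain ⟨n, hn⟩ : ∃ n, z ^ (n + 1) = 1 :=
      ⟨orderOf z - 1, by rw [Nat.sub_add_cancel (orderOf_pos z), pow_orderOf_eq_one]⟩
    have h7 := conj_mul_conj z e ((z ^ n : Rˣ) * e * ((z ^ n)⁻¹ : Rˣ))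
    rw [mul_conj_pow he h5] at h7
    have h8 : z * ((z ^ n : Rˣ) * e * ((z ^ n)⁻¹ : Rˣ)) * (z⁻¹ : Rˣ) = e := by
      have : ((z ^ (n + 1) : Rˣ) : R) * e * ((z ^ (n + 1))⁻¹ : Rˣ) = e := by simp [hn]
      refine Eq.trans ?_ this
      simp only [pow_succ', mul_inv_rev, Units.val_mul, mul_assoc]
    rw [h8, ← hR.idem_comm _ _ he hz, h5] at h7
    exact h7.symm
  rw [h6] at h3
  rw [← h3, ← hR.idem_comm _ _ he hF, hu]

end Idempotents

/-! ### The refined normal form x₀ d e y and Green's relations. -/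

section NormalForm

variable {B R : Type*} [Monoid R] {M : CoxeterMatrix B} {cs : CoxeterSystem M Rˣ} {Λ : Set R}

/-- `r = x₀ d e y` with `e ∈ Λ`, `x₀ ∈ W^{λ(e)}`, `d ∈ W_{λ^*(e)}` and `y ∈ ^{λ(e)}W`. -/
structure IsNormalForm (cs : CoxeterSystem M Rˣ) (Λ : Set R) (r : R) (x₀ d : Rˣ) (e : R)
    (y : Rˣ) : Prop where
  eq : r = (x₀ * d : Rˣ) * e * y
  mem : e ∈ Λ
  left : CosetMin cs (typeMap cs e) x₀
  mid : d ∈ parabolic cs (upperType cs e)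
  right : CosetMin cs (typeMap cs e) y⁻¹

theorem parabolic_upperType_le (cs : CoxeterSystem M Rˣ) (e : R) :
    parabolic cs (upperType cs e) ≤ parabolic cs (typeMap cs e) :=
  parabolic_mono fun _ hi => hi.1

theorem parabolic_lowerType_le (cs : CoxeterSystem M Rˣ) (e : R) :
    parabolic cs (lowerType cs e) ≤ parabolic cs (typeMap cs e) :=
  parabolic_mono fun _ hi => hi.1.trans hi.2.symm

variable (hΛ : IsRennerCoxeterSystem cs Λ)
include hΛ

theorem IsRennerCoxeterSystem.eq_of_conj {e f : R} (he : e ∈ Λ) (hf : f ∈ Λ) {w : Rˣ}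
    (h : w * e * (w⁻¹ : Rˣ) = f) : e = f :=
  (hΛ.transversal e (hΛ.idem e he)).unique ⟨he, 1, by simp⟩ ⟨hf, w, h⟩

theorem IsRennerCoxeterSystem.mem_of_conj {e : R} (he : e ∈ Λ) {w : Rˣ}
    (h : w * e * (w⁻¹ : Rˣ) = e) : w ∈ parabolic cs (typeMap cs e) := by
  rw [mem_parabolic_typeMap hΛ he]
  nth_rw 2 [← h]
  simp [mul_assoc]

/-- One-sided fixing suffices: wew⁻¹ = ew⁻¹ is an idempotent equal to e times a unit, hence is e. -/
theorem IsRennerCoxeterSystem.mem_lowerType_of_mul_eq {e : R} (he : e ∈ Λ) {w : Rˣ}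
    (h : w * e = e) : w ∈ parabolic cs (lowerType cs e) := by
  have hi := hΛ.idem e he
  have h1 := hΛ.factorizable.eq_of_eq_mul_unit (e := w * e * (w⁻¹ : Rˣ)) (f := e) (z := w⁻¹)
    (isIdempotentElem_conj hi w) hi (by rw [h])
  rw [mem_parabolic_lowerType hΛ he]
  refine ⟨h, ?_⟩
  rw [← (mem_parabolic_typeMap hΛ he w).1 (hΛ.mem_of_conj he h1), h]

/-- Conjugate the idempotent of r into Λ, move the W_{λ(e)}-part of the right factor across e, and
let e absorb the W_{λ_*(e)}-part of the left factor. -/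
theorem IsRennerCoxeterSystem.exists_isNormalForm (r : R) :
    ∃ x₀ d e y, IsNormalForm cs Λ r x₀ d e y := by
  obtain ⟨g, hg, w, rfl⟩ := hΛ.factorizable.exists_idem_mul_unit r
  obtain ⟨e, ⟨he, u, hu⟩, -⟩ := hΛ.transversal g hg
  obtain ⟨y, c, hy, hc, h1⟩ := exists_cosetMin (cs := cs) (typeMap cs e) (u * w)⁻¹
  obtain ⟨x₀, c', hx, hc', h2⟩ := exists_cosetMin (cs := cs) (typeMap cs e) (u⁻¹ * c⁻¹)
  rw [← upperType_union_lowerType] at hc'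
  obtain ⟨d, hd, n, hn, rfl⟩ := (isProductPair_upperType_lowerType hΛ he).exists_eq_mul hc'
  refine ⟨x₀, d, e, y⁻¹, ?_, he, hx, hd, by simpa using hy⟩
  have h3 := (mem_parabolic_typeMap hΛ he _).1 (inv_mem hc)
  have h4 := ((mem_parabolic_lowerType hΛ he _).1 hn).1
  have h5 : x₀ * d = u⁻¹ * c⁻¹ * n⁻¹ := by rw [h2]; group
  have h6 : ((n⁻¹ : Rˣ) : R) * e = e := by
    nth_rw 1 [← h4]; simp
  have h7 : y⁻¹ = c * (u * w) := by
    rw [← inv_inv (u * w), h1]; group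
  rw [h5, h7, Units.val_mul, mul_assoc _ _ e, h6, Units.val_mul, mul_assoc _ _ e, h3, ← hu]
  simp [mul_assoc]

variable {r s : R} {x₀ d y x₀' d' y' : Rˣ} {e e' : R} (hr : IsNormalForm cs Λ r x₀ d e y)
  (hs : IsNormalForm cs Λ s x₀' d' e' y')
include hr hs

/-- The 𝓛-class determines the idempotent y⁻¹ey. Transversality then recovers e, and minimality
recovers y from its coset of the centralizer. -/
theorem IsNormalForm.greenL_iff : GreenL r s ↔ e = e' ∧ y = y' := by
  have hi := hΛ.idem e hr.mem
  have hi' := hΛ.idem e' hs.mem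
  constructor
  · intro h
    obtain ⟨⟨p, hp⟩, q, hq⟩ := RennerCoxeter.greenL_iff.1 h
    have key : ∀ {r s : R} {x y x' y' : Rˣ} {e e' p : R}, r = x * e * y → s = x' * e' * y' →
        IsIdempotentElem e' → r = p * s →
        (y⁻¹ : Rˣ) * e * y * ((y'⁻¹ : Rˣ) * e' * y') = (y⁻¹ : Rˣ) * e * y := by
      intro r s x y x' y' e e' p hr hs hi' hp
      have h1 : r * ((y'⁻¹ : Rˣ) * e' * y') = r := by
        have : s * ((y'⁻¹ : Rˣ) * e' * y') = s := by
          rw [hs]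
          simp only [mul_assoc, Units.mul_inv_cancel_left]
          rw [← mul_assoc e', hi'.eq]
        rw [hp, mul_assoc, this]
      have h2 : (y⁻¹ : Rˣ) * e * y = ((y⁻¹ * x⁻¹ : Rˣ) : R) * r := by
        rw [hr]; simp [mul_assoc]
      rw [h2, mul_assoc, h1]
    have h1 := key hr.eq hs.eq hi' hp
    have h2 := key hs.eq hr.eq hi hq
    have c1 := isIdempotentElem_conj hi y⁻¹
    have c2 := isIdempotentElem_conj hi' y'⁻¹
    rw [inv_inv] at c1 c2
    rw [hΛ.factorizable.idem_comm _ _ c2 c1, h1] at h2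
    have h3 : ((y' * y⁻¹ : Rˣ) : R) * e * ((y' * y⁻¹)⁻¹ : Rˣ) = e' := by
      have := congrArg (fun g : R => y' * g * (y'⁻¹ : Rˣ)) h2
      simpa [mul_assoc] using this
    obtain rfl := hΛ.eq_of_conj hr.mem hs.mem h3
    refine ⟨rfl, ?_⟩
    have h4 := hs.right.unique hr.right (by simpa using hΛ.mem_of_conj hr.mem h3)
    exact (inv_injective h4).symm
  · rintro ⟨rfl, rfl⟩
    refine RennerCoxeter.greenL_iff.2
      ⟨⟨((x₀ * d * (x₀' * d')⁻¹ : Rˣ) : R), ?_⟩, ((x₀' * d' * (x₀ * d)⁻¹ : Rˣ) : R), ?_⟩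
    · rw [hr.eq, hs.eq]; simp [mul_assoc]
    · rw [hr.eq, hs.eq]; simp [mul_assoc]

theorem IsNormalForm.greenR_iff : GreenR r s ↔ e = e' ∧ x₀ = x₀' := by
  have hi := hΛ.idem e hr.mem
  have hi' := hΛ.idem e' hs.mem
  constructor
  · intro h
    obtain ⟨⟨p, hp⟩, q, hq⟩ := RennerCoxeter.greenR_iff.1 h
    have key : ∀ {r s : R} {x y x' y' : Rˣ} {e e' p : R}, r = x * e * y → s = x' * e' * y' →
        IsIdempotentElem e' → r = s * p →
        x' * e' * (x'⁻¹ : Rˣ) * (x * e * (x⁻¹ : Rˣ)) = x * e * (x⁻¹ : Rˣ) := by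
      intro r s x y x' y' e e' p hr hs hi' hp
      have h1 : x' * e' * (x'⁻¹ : Rˣ) * r = r := by
        have : x' * e' * (x'⁻¹ : Rˣ) * s = s := by
          rw [hs]
          simp only [mul_assoc, Units.inv_mul_cancel_left]
          rw [← mul_assoc e', hi'.eq]
        rw [hp, ← mul_assoc, this]
      have h2 : x * e * (x⁻¹ : Rˣ) = r * ((y⁻¹ * x⁻¹ : Rˣ) : R) := by
        rw [hr]; simp [mul_assoc]
      rw [h2, ← mul_assoc, h1]
    have h1 := key hr.eq hs.eq hi' hp
    have h2 := key hs.eq hr.eq hi hq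
    rw [hΛ.factorizable.idem_comm _ _ (isIdempotentElem_conj hi _) (isIdempotentElem_conj hi' _),
      h1] at h2
    have h3 : (((x₀' * d')⁻¹ * (x₀ * d) : Rˣ) : R) * e * (((x₀' * d')⁻¹ * (x₀ * d))⁻¹ : Rˣ) =
        e' := by
      have := congrArg (fun g : R => ((x₀' * d')⁻¹ : Rˣ) * g * ((x₀' * d' : Rˣ) : R)) h2
      simpa [mul_assoc] using this
    obtain rfl := hΛ.eq_of_conj hr.mem hs.mem h3
    refine ⟨rfl, (hs.left.unique hr.left ?_).symm⟩
    have h4 := hΛ.mem_of_conj hr.mem h3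
    -- The element known to centralize e involves d and d', which themselves lie in W_{λ(e)} and can
    -- be stripped off.
    have h5 : x₀'⁻¹ * x₀ = d' * ((x₀' * d')⁻¹ * (x₀ * d)) * d⁻¹ := by group
    rw [h5]
    exact mul_mem (mul_mem (parabolic_upperType_le cs e hs.mid) h4)
      (inv_mem (parabolic_upperType_le cs e hr.mid))
  · rintro ⟨rfl, rfl⟩
    have key : ∀ {d : Rˣ}, d ∈ parabolic cs (upperType cs e) → ∀ y : Rˣ,
        ((x₀ * d : Rˣ) : R) * e * y = x₀ * e * ((d * y : Rˣ) : R) := by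
      intro d hd y
      rw [Units.val_mul, mul_assoc (x₀ : R),
        (mem_parabolic_typeMap hΛ hr.mem d).1 (parabolic_upperType_le cs e hd)]
      simp [mul_assoc]
    refine RennerCoxeter.greenR_iff.2
      ⟨⟨(((d' * y')⁻¹ * (d * y) : Rˣ) : R), ?_⟩, (((d * y)⁻¹ * (d' * y') : Rˣ) : R), ?_⟩
    · rw [hr.eq, hs.eq, key hr.mid, key hs.mid]; simp [mul_assoc]
    · rw [hr.eq, hs.eq, key hr.mid, key hs.mid]; simp [mul_assoc]

theorem IsNormalForm.greenJ_iff [Finite R] : GreenJ r s ↔ e = e' := by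
  have h1 : GreenJ r e := hr.eq ▸ greenJ_units _ _ _
  have h2 : GreenJ s e' := hs.eq ▸ greenJ_units _ _ _
  constructor
  · intro h
    obtain ⟨u, hu⟩ := hΛ.factorizable.exists_conj_eq_of_greenJ (hΛ.idem e hr.mem)
      (hΛ.idem e' hs.mem) (h1.symm.trans (h.trans h2))
    exact (hΛ.eq_of_conj hs.mem hr.mem hu).symm
  · rintro rfl
    exact h1.trans h2.symm

omit hs in
-- Reflexivity of 𝓛 and 𝓡 already gives e, y and x₀. Then d'⁻¹d fixes e, so it lies in both direct
-- factors.
theorem IsNormalForm.unique (hs : IsNormalForm cs Λ r x₀' d' e' y') :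
    x₀ = x₀' ∧ d = d' ∧ e = e' ∧ y = y' := by
  obtain ⟨rfl, rfl⟩ := (hr.greenL_iff hΛ hs).1 rfl
  obtain ⟨-, rfl⟩ := (hr.greenR_iff hΛ hs).1 rfl
  refine ⟨rfl, ?_, rfl, rfl⟩
  have h1 := hr.eq.symm.trans hs.eq
  rw [Units.mul_left_inj, Units.val_mul, Units.val_mul, mul_assoc, mul_assoc,
    Units.mul_right_inj] at h1
  have h2 : d'⁻¹ * d ∈ parabolic cs (lowerType cs e) := by
    refine hΛ.mem_lowerType_of_mul_eq hr.mem ?_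
    rw [Units.val_mul, mul_assoc, h1]
    simp
  exact (inv_mul_eq_one.1 ((isProductPair_upperType_lowerType hΛ hr.mem).eq_one _
    (mul_mem (inv_mem hs.mid) hr.mid) h2)).symm

end NormalForm

/-! ### The order ≤⁺ on normal forms. -/

section AdherencePlus

variable {B R : Type*} [Monoid R] {M : CoxeterMatrix B} {cs : CoxeterSystem M Rˣ} {Λ : Set R}
  (hΛ : IsRennerCoxeterSystem cs Λ)
include hΛ

theorem IsNormalForm.isLeftStandardForm {r e : R} {x₀ d y : Rˣ}
    (h : IsNormalForm cs Λ r x₀ d e y) : IsLeftStandardForm cs Λ r (x₀ * d) e y := by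
  refine ⟨h.eq, h.mem, mem_minReps_empty_left_iff.2 ?_, mem_minReps_empty_right_iff.2 h.right⟩
  refine (isProductPair_upperType_lowerType hΛ h.mem).cosetMin_mul ?_ h.mid
  rw [upperType_union_lowerType]
  exact h.left

theorem IsLeftStandardForm.exists_isNormalForm {r e : R} {x y : Rˣ}
    (h : IsLeftStandardForm cs Λ r x e y) :
    ∃ x₀ d, x = x₀ * d ∧ IsNormalForm cs Λ r x₀ d e y := by
  obtain ⟨h1, h2, h3, h4⟩ := h
  obtain ⟨x₀, d, h5, h6, rfl⟩ := (isProductPair_upperType_lowerType hΛ h2).exists_of_cosetMin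
    (mem_minReps_empty_left_iff.1 h3)
  rw [upperType_union_lowerType] at h5
  exact ⟨x₀, d, rfl, h1, h2, h5, h6, mem_minReps_empty_right_iff.1 h4⟩

theorem IsLeftStandardForm.unique {r e e' : R} {x y x' y' : Rˣ}
    (h : IsLeftStandardForm cs Λ r x e y) (h' : IsLeftStandardForm cs Λ r x' e' y') :
    x = x' ∧ e = e' ∧ y = y' := by
  obtain ⟨x₀, d, rfl, h1⟩ := h.exists_isNormalForm hΛ
  obtain ⟨x₀', d', rfl, h2⟩ := h'.exists_isNormalForm hΛ
  obtain ⟨rfl, rfl, rfl, rfl⟩ := h1.unique hΛ h2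
  exact ⟨rfl, rfl, rfl⟩

/-- The case w = 1 of the definition; it is the only one needed to establish extremality. -/
theorem adhPlus_of_bruhatLE {r s e : R} {x₀ d y x₀' d' y' : Rˣ}
    (hr : IsNormalForm cs Λ r x₀ d e y) (hs : IsNormalForm cs Λ s x₀' d' e y')
    (hx : BruhatLE cs (x₀ * d) (x₀' * d')) (hy : BruhatLE cs y' y) : AdhPlus cs Λ r s := by
  have he := (hΛ.idem e hr.mem).eq
  exact ⟨_, _, _, _, _, _, hr.isLeftStandardForm hΛ, hs.isLeftStandardForm hΛ, ⟨he, he⟩,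
    1, one_mem _, 1, one_mem _, by simpa using hx, by simpa using hy⟩

/-- The two idempotents agree, and minimality of y and b makes lengths add in w⁻¹b. The two
resulting inequalities between ℓ(y) and ℓ(b) force both twisting elements w to be 1. -/
theorem AdhPlus.antisymm {r s : R} (h : AdhPlus cs Λ r s) (h' : AdhPlus cs Λ s r) : r = s := by
  obtain ⟨x, e, y, a, f, b, hr, hs, hef, u, hu, v, hv, h1, h2⟩ := h
  obtain ⟨a', f', b', x', e', y', hs', hr', hfe, u', hu', v', hv', h3, h4⟩ := h'
  obtain ⟨rfl, rfl, rfl⟩ := hs.unique hΛ hs'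
  obtain ⟨rfl, rfl, rfl⟩ := hr.unique hΛ hr'
  have hee : e = f := by rw [← hef.1, hfe.2]
  subst hee
  have key : ∀ {u v b : Rˣ}, u ∈ parabolic cs (upperType cs e) →
      v ∈ parabolic cs (lowerType cs e) → b ∈ minReps cs (typeMap cs e) ∅ →
      cs.length ((u * v)⁻¹ * b) = cs.length b + cs.length (u * v) := by
    intro u v b hu hv hb
    rw [← cs.length_inv, mul_inv_rev, inv_inv, mem_minReps_empty_right_iff.1 hb, cs.length_inv]
    exact mul_mem (parabolic_upperType_le cs e hu) (parabolic_lowerType_le cs e hv)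
  have k1 := key hu hv hs.2.2.2
  have k2 := key hu' hv' hr.2.2.2
  have l1 := h2.length_le
  have l2 := h4.length_le
  have e1 : u * v = 1 := cs.length_eq_zero_iff.1 (by omega)
  have e2 : u' * v' = 1 := cs.length_eq_zero_iff.1 (by omega)
  rw [e1, mul_one] at h1
  rw [e1, inv_one, one_mul] at h2
  rw [e2, mul_one] at h3
  rw [e2, inv_one, one_mul] at h4
  rw [hr.1, hs.1, h1.antisymm h3, h2.antisymm h4]

end AdherencePlus

/-! ### Extremal elements of the Green classes for ≤⁺. -/

section Extremal

variable {B R : Type*} [Monoid R] [Finite R] {M : CoxeterMatrix B} {cs : CoxeterSystem M Rˣ}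
  {Λ : Set R} {r e : R} {x₀ d y : Rˣ}

omit [Finite R] in
theorem IsNormalForm.change (hr : IsNormalForm cs Λ r x₀ d e y) {x₀' d' y' : Rˣ}
    (hx : CosetMin cs (typeMap cs e) x₀') (hd : d' ∈ parabolic cs (upperType cs e))
    (hy : CosetMin cs (typeMap cs e) y'⁻¹) :
    IsNormalForm cs Λ ((x₀' * d' : Rˣ) * e * y') x₀' d' e y' := ⟨rfl, hr.mem, hx, hd, hy⟩

omit [Finite R] in
theorem CosetMin.bruhatLE_mul {J : Set B} {x : Rˣ} (hx : CosetMin cs J x) {v : Rˣ}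
    (hv : v ∈ parabolic cs J) : BruhatLE cs (x * 1) (x * v) := by
  rw [mul_one]
  exact bruhatLE_mul_right (hx v hv)

omit [Finite R] in
theorem CosetMin.mul_bruhatLE {I J : Set B} (hIJ : I ⊆ J) {w : Rˣ} (hw : IsLongest cs I w)
    {x : Rˣ} (hx : CosetMin cs J x) {v : Rˣ} (hv : v ∈ parabolic cs I) :
    BruhatLE cs (x * v) (x * w) := by
  have h1 : x * w = x * v * (v⁻¹ * w) := by group
  have h2 := hw.length_mul_add (inv_mem hv)
  rw [cs.length_inv] at h2
  have hle := parabolic_mono (cs := cs) hIJ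
  rw [h1]
  refine bruhatLE_mul_right ?_
  rw [← h1, hx _ (hle hw.mem), hx _ (hle hv)]
  omega

theorem cosetMin_inv_mul_longest {J : Set B} {w : Rˣ} (hw : IsLongest cs J w) :
    CosetMin cs J (w * longest cs)⁻¹ := by
  rw [mul_inv_rev, longest_inv, hw.inv_eq]
  exact hw.longest_mul

variable (hΛ : IsRennerCoxeterSystem cs Λ) (hr : IsNormalForm cs Λ r x₀ d e y) {wC wD : Rˣ}
  (hC : IsLongest cs (typeMap cs e) wC) (hD : IsLongest cs (upperType cs e) wD)
include hΛ hr

omit [Finite R] in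
theorem IsNormalForm.isAbsMin_greenH :
    IsAbsMin cs Λ Sign.plus GreenH r ((x₀ * 1 : Rˣ) * e * y) := by
  have hm := hr.change hr.left (one_mem _) hr.right
  refine ⟨⟨(hr.greenL_iff hΛ hm).2 ⟨rfl, rfl⟩, (hr.greenR_iff hΛ hm).2 ⟨rfl, rfl⟩⟩,
    fun t ht => ?_⟩
  obtain ⟨x₀', d', e', y', h⟩ := hΛ.exists_isNormalForm t
  obtain ⟨rfl, rfl⟩ := (hr.greenL_iff hΛ h).1 ht.1
  obtain ⟨-, rfl⟩ := (hr.greenR_iff hΛ h).1 ht.2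
  exact adhPlus_of_bruhatLE hΛ hm h
    (h.left.bruhatLE_mul (parabolic_upperType_le cs e h.mid)) (bruhatLE_refl _)

omit [Finite R] in
theorem IsNormalForm.isAbsMin_greenL :
    IsAbsMin cs Λ Sign.plus GreenL r ((1 * 1 : Rˣ) * e * y) := by
  have hm := hr.change cosetMin_one (one_mem _) hr.right
  refine ⟨(hr.greenL_iff hΛ hm).2 ⟨rfl, rfl⟩, fun t ht => ?_⟩
  obtain ⟨x₀', d', e', y', h⟩ := hΛ.exists_isNormalForm t
  obtain ⟨rfl, rfl⟩ := (hr.greenL_iff hΛ h).1 ht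
  exact adhPlus_of_bruhatLE hΛ hm h (by simpa using bruhatLE_one _) (bruhatLE_refl _)

include hC in
-- The right factor enters ≤⁺ reversed, so the minimum takes the Bruhat-largest element wC w₀ of
-- ^{λ(e)}W.
theorem IsNormalForm.isAbsMin_greenR :
    IsAbsMin cs Λ Sign.plus GreenR r
      ((x₀ * 1 : Rˣ) * e * ((wC * longest cs : Rˣ) : R)) := by
  have hm := hr.change hr.left (one_mem _) (cosetMin_inv_mul_longest hC)
  refine ⟨(hr.greenR_iff hΛ hm).2 ⟨rfl, rfl⟩, fun t ht => ?_⟩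
  obtain ⟨x₀', d', e', y', h⟩ := hΛ.exists_isNormalForm t
  obtain ⟨rfl, rfl⟩ := (hr.greenR_iff hΛ h).1 ht
  exact adhPlus_of_bruhatLE hΛ hm h (h.left.bruhatLE_mul (parabolic_upperType_le cs e h.mid))
    (bruhatLE_mul_longest_of_cosetMin_inv hC h.right)

include hC in
theorem IsNormalForm.isAbsMin_greenJ :
    IsAbsMin cs Λ Sign.plus GreenJ r
      ((1 * 1 : Rˣ) * e * ((wC * longest cs : Rˣ) : R)) := by
  have hm := hr.change cosetMin_one (one_mem _) (cosetMin_inv_mul_longest hC)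
  refine ⟨(hr.greenJ_iff hΛ hm).2 rfl, fun t ht => ?_⟩
  obtain ⟨x₀', d', e', y', h⟩ := hΛ.exists_isNormalForm t
  obtain rfl := (hr.greenJ_iff hΛ h).1 ht
  exact adhPlus_of_bruhatLE hΛ hm h (by simpa using bruhatLE_one _)
    (bruhatLE_mul_longest_of_cosetMin_inv hC h.right)

include hD

omit [Finite R] in
theorem IsNormalForm.isAbsMax_greenH :
    IsAbsMax cs Λ Sign.plus GreenH r ((x₀ * wD : Rˣ) * e * y) := by
  have hm := hr.change hr.left hD.mem hr.right
  refine ⟨⟨(hr.greenL_iff hΛ hm).2 ⟨rfl, rfl⟩, (hr.greenR_iff hΛ hm).2 ⟨rfl, rfl⟩⟩,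
    fun t ht => ?_⟩
  obtain ⟨x₀', d', e', y', h⟩ := hΛ.exists_isNormalForm t
  obtain ⟨rfl, rfl⟩ := (hr.greenL_iff hΛ h).1 ht.1
  obtain ⟨-, rfl⟩ := (hr.greenR_iff hΛ h).1 ht.2
  exact adhPlus_of_bruhatLE hΛ h hm (h.left.mul_bruhatLE (fun _ hi => hi.1) hD h.mid)
    (bruhatLE_refl _)

omit [Finite R] in
theorem IsNormalForm.isAbsMax_greenR :
    IsAbsMax cs Λ Sign.plus GreenR r ((x₀ * wD : Rˣ) * e * ((1 : Rˣ) : R)) := by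
  have hm := hr.change hr.left hD.mem (y' := 1) (by simpa using cosetMin_one)
  refine ⟨(hr.greenR_iff hΛ hm).2 ⟨rfl, rfl⟩, fun t ht => ?_⟩
  obtain ⟨x₀', d', e', y', h⟩ := hΛ.exists_isNormalForm t
  obtain ⟨rfl, rfl⟩ := (hr.greenR_iff hΛ h).1 ht
  exact adhPlus_of_bruhatLE hΛ h hm (h.left.mul_bruhatLE (fun _ hi => hi.1) hD h.mid)
    (bruhatLE_one _)

include hC

/-- Here x₀d lies in W^{λ_*(e)}, whose Bruhat maximum is w₀wN = w₀ wC wD. -/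
theorem IsNormalForm.bruhatLE_longest :
    BruhatLE cs (x₀ * d) (longest cs * wC * wD) := by
  have hp := isProductPair_upperType_lowerType hΛ hr.mem
  obtain ⟨wN, hN⟩ := exists_isLongest cs (lowerType cs e)
  have hU := hp.isLongest hD hN
  rw [upperType_union_lowerType] at hU
  have hw : wC * wD = wN := by
    rw [hU.eq_of_length_le hC.mem (hC.length_le _ hU.mem), (hp.commute _ hD.mem _ hN.mem).eq,
      mul_assoc, hD.mul_self, mul_one]
  rw [mul_assoc, hw]
  refine (hp.cosetMin_mul ?_ hr.mid).bruhatLE_longest_mul hN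
  rw [upperType_union_lowerType]
  exact hr.left

theorem IsNormalForm.isAbsMax_greenL :
    IsAbsMax cs Λ Sign.plus GreenL r
      ((longest cs * wC * wD : Rˣ) * e * y) := by
  have hm := hr.change hC.longest_mul hD.mem hr.right
  refine ⟨(hr.greenL_iff hΛ hm).2 ⟨rfl, rfl⟩, fun t ht => ?_⟩
  obtain ⟨x₀', d', e', y', h⟩ := hΛ.exists_isNormalForm t
  obtain ⟨rfl, rfl⟩ := (hr.greenL_iff hΛ h).1 ht
  exact adhPlus_of_bruhatLE hΛ h hm (h.bruhatLE_longest hΛ hC hD) (bruhatLE_refl _)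

theorem IsNormalForm.isAbsMax_greenJ :
    IsAbsMax cs Λ Sign.plus GreenJ r
      ((longest cs * wC * wD : Rˣ) * e * ((1 : Rˣ) : R)) := by
  have hm := hr.change hC.longest_mul hD.mem (y' := 1) (by simpa using cosetMin_one)
  refine ⟨(hr.greenJ_iff hΛ hm).2 rfl, fun t ht => ?_⟩
  obtain ⟨x₀', d', e', y', h⟩ := hΛ.exists_isNormalForm t
  obtain rfl := (hr.greenJ_iff hΛ h).1 ht
  exact adhPlus_of_bruhatLE hΛ h hm (h.bruhatLE_longest hΛ hC hD) (bruhatLE_one _)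

end Extremal

/-! ### Uniqueness of absolute extrema for ≤⁺. -/

section Uniqueness

variable {B R : Type*} [Monoid R] {M : CoxeterMatrix B} {cs : CoxeterSystem M Rˣ} {Λ : Set R}
  (hΛ : IsRennerCoxeterSystem cs Λ) {T : R → R → Prop} {r m m' : R}
include hΛ

theorem IsAbsMin.unique (h : IsAbsMin cs Λ Sign.plus T r m)
    (h' : IsAbsMin cs Λ Sign.plus T r m') : m = m' :=
  AdhPlus.antisymm hΛ (h.2 _ h'.1) (h'.2 _ h.1)

theorem IsAbsMax.unique (h : IsAbsMax cs Λ Sign.plus T r m)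
    (h' : IsAbsMax cs Λ Sign.plus T r m') : m = m' :=
  AdhPlus.antisymm hΛ (h'.2 _ h.1) (h.2 _ h'.1)

theorem IsAbsMin.self_iff (h : IsAbsMin cs Λ Sign.plus T r m) :
    IsAbsMin cs Λ Sign.plus T r r ↔ r = m :=
  ⟨fun h' => h'.unique hΛ h, fun h' => by nth_rw 2 [h']; exact h⟩

theorem IsAbsMax.self_iff (h : IsAbsMax cs Λ Sign.plus T r m) :
    IsAbsMax cs Λ Sign.plus T r r ↔ r = m :=
  ⟨fun h' => h'.unique hΛ h, fun h' => by nth_rw 2 [h']; exact h⟩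

end Uniqueness

/-! ### Conjugation by w₀ and the type maps. -/

section VanillaPlus

variable {B R : Type*} [Monoid R] [Finite R] {M : CoxeterMatrix B} {cs : CoxeterSystem M Rˣ}
  {Λ : Set R}

/-- The conjugate `w₀ e w₀`. -/
noncomputable def conjLongest (cs : CoxeterSystem M Rˣ) (e : R) : R :=
  (longest cs : Rˣ) * e * (longest cs : Rˣ)

theorem longest_mul_self_val :
    ((longest cs : Rˣ) : R) * ((longest cs : Rˣ) : R) = 1 := by
  rw [← Units.val_mul, longest_mul_self, Units.val_one]

theorem longest_mul_cancel_left_val (a : R) :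
    ((longest cs : Rˣ) : R) * (((longest cs : Rˣ) : R) * a) = a := by
  rw [← mul_assoc, longest_mul_self_val, one_mul]

theorem conjLongest_conjLongest (e : R) : conjLongest cs (conjLongest cs e) = e := by
  simp only [conjLongest, mul_assoc, longest_mul_cancel_left_val, longest_mul_self_val, mul_one]

theorem mul_conjLongest_eq_iff (w : Rˣ) (a b : R) :
    (w : R) * conjLongest cs a = conjLongest cs b ↔
      ((longest cs * w * longest cs : Rˣ) : R) * a = b := by
  constructor
  · intro h
    have := congrArg (conjLongest cs) h
    rw [conjLongest_conjLongest] at this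
    rw [← this]
    simp only [conjLongest, Units.val_mul, mul_assoc, longest_mul_self_val, mul_one]
  · rintro rfl
    simp only [conjLongest, Units.val_mul, mul_assoc, longest_mul_cancel_left_val]

theorem conjLongest_mul (w : Rˣ) (a : R) :
    conjLongest cs a * (w : R) =
      conjLongest cs (a * ((longest cs * w * longest cs : Rˣ) : R)) := by
  simp only [conjLongest, Units.val_mul, mul_assoc, longest_mul_self_val, mul_one]

theorem conjLongest_injective : Function.Injective (conjLongest (R := R) cs) :=
  Function.LeftInverse.injective conjLongest_conjLongest

/-- Each of the three type maps has the form {i | P(s_i)}, and w₀ permutes the simple reflections by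
conjugation; this treats all three at once. -/
theorem mem_parabolic_of_conj_simple {P Q : Rˣ → Prop}
    (hPQ : ∀ w, P w ↔ Q (longest cs * w * longest cs)) (v : Rˣ) :
    v ∈ parabolic cs {i | P (cs.simple i)} ↔
      longest cs * v * longest cs ∈ parabolic cs {i | Q (cs.simple i)} := by
  have hPQ' : ∀ w, Q w ↔ P (longest cs * w * longest cs) := fun w => by
    rw [hPQ]; simp only [mul_assoc, longest_mul_cancel_left, longest_mul_self, mul_one]
  have key : ∀ {P Q : Rˣ → Prop}, (∀ w, P w ↔ Q (longest cs * w * longest cs)) → ∀ v,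
      v ∈ parabolic cs {i | P (cs.simple i)} →
      longest cs * v * longest cs ∈ parabolic cs {i | Q (cs.simple i)} := by
    intro P Q hPQ v hv
    refine longest_conj_mem_parabolic (fun i hi => ?_) hv
    obtain ⟨j, hj⟩ := exists_longest_conj_simple (cs := cs) i
    exact ⟨j, show Q _ from hj ▸ (hPQ _).1 hi, hj⟩
  refine ⟨key hPQ v, fun h => ?_⟩
  have := key hPQ' _ h
  simpa only [mul_assoc, longest_mul_cancel_left, longest_mul_self, mul_one] using this

theorem mem_parabolic_typeMap_conjLongest (e : R) (v : Rˣ) :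
    v ∈ parabolic cs (typeMap cs (conjLongest cs e)) ↔
      longest cs * v * longest cs ∈ parabolic cs (typeMap cs e) :=
  mem_parabolic_of_conj_simple
    (P := fun w : Rˣ => (w : R) * conjLongest cs e = conjLongest cs e * (w : R))
    (Q := fun w : Rˣ => (w : R) * e = e * (w : R))
    (fun w => by rw [conjLongest_mul, mul_conjLongest_eq_iff]) v

theorem mem_parabolic_lowerType_conjLongest (e : R) (v : Rˣ) :
    v ∈ parabolic cs (lowerType cs (conjLongest cs e)) ↔
      longest cs * v * longest cs ∈ parabolic cs (lowerType cs e) :=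
  mem_parabolic_of_conj_simple
    (P := fun w : Rˣ => (w : R) * conjLongest cs e = conjLongest cs e ∧
      conjLongest cs e * (w : R) = conjLongest cs e)
    (Q := fun w : Rˣ => (w : R) * e = e ∧ e * (w : R) = e)
    (fun w => by rw [conjLongest_mul, mul_conjLongest_eq_iff, conjLongest_injective.eq_iff]) v

theorem mem_parabolic_upperType_conjLongest (e : R) (v : Rˣ) :
    v ∈ parabolic cs (upperType cs (conjLongest cs e)) ↔
      longest cs * v * longest cs ∈ parabolic cs (upperType cs e) :=
  mem_parabolic_of_conj_simple
    (P := fun w : Rˣ => (w : R) * conjLongest cs e = conjLongest cs e * (w : R) ∧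
      conjLongest cs e * (w : R) ≠ conjLongest cs e)
    (Q := fun w : Rˣ => (w : R) * e = e * (w : R) ∧ e * (w : R) ≠ e)
    (fun w => by
      rw [conjLongest_mul, mul_conjLongest_eq_iff, Ne, conjLongest_injective.eq_iff]) v

end VanillaPlus

/-! ### Vanilla forms and the theorem for ≤⁺. -/

section VanillaPlus

variable {B R : Type*} [Monoid R] [Finite R] {M : CoxeterMatrix B} {cs : CoxeterSystem M Rˣ}
  {Λ : Set R} (hΛ : IsRennerCoxeterSystem cs Λ)

theorem length_longest_conj (v : Rˣ) :
    cs.length (longest cs * v * longest cs) = cs.length v := by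
  have h1 := length_mul_longest_add (cs := cs) (longest cs * v)
  have h2 := length_longest_mul_add (cs := cs) v
  omega

theorem isLongest_conjLongest {e : R} {w : Rˣ} (hw : IsLongest cs (typeMap cs e) w) :
    IsLongest cs (typeMap cs (conjLongest cs e)) (longest cs * w * longest cs) := by
  constructor
  · rw [mem_parabolic_typeMap_conjLongest]
    simpa only [mul_assoc, longest_mul_cancel_left, longest_mul_self, mul_one] using hw.mem
  · intro v hv
    rw [length_longest_conj, ← length_longest_conj v]
    exact hw.length_le _ ((mem_parabolic_typeMap_conjLongest e v).1 hv)

/-- The vanilla form of the element with normal form `x₀ d e y`. -/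
noncomputable def vanillaData (cs : CoxeterSystem M Rˣ) (wC x₀ d : Rˣ) (e : R) (y : Rˣ) :
    VanillaData R :=
  ⟨x₀ * wC * longest cs, conjLongest cs e, longest cs * wC * d, e, y⟩

variable {r e : R} {x₀ d y wC wD wN : Rˣ}

omit [Finite R] in
include hΛ in
theorem isLongest_eq_mul (he : e ∈ Λ) (hC : IsLongest cs (typeMap cs e) wC)
    (hD : IsLongest cs (upperType cs e) wD) (hN : IsLongest cs (lowerType cs e) wN) :
    wC = wN * wD := by
  have hp := isProductPair_upperType_lowerType hΛ he
  have hU := hp.isLongest hD hN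
  rw [upperType_union_lowerType] at hU
  rw [hU.eq_of_length_le hC.mem (hC.length_le _ hU.mem), (hp.commute _ hD.mem _ hN.mem).eq]

include hΛ in
theorem IsNormalForm.isVanillaForm (hr : IsNormalForm cs Λ r x₀ d e y)
    (hC : IsLongest cs (typeMap cs e) wC) :
    IsVanillaForm cs Λ r (vanillaData cs wC x₀ d e y) := by
  obtain ⟨wN, hN⟩ := exists_isLongest cs (lowerType cs e)
  obtain ⟨wD, hD⟩ := exists_isLongest cs (upperType cs e)
  have hi := hΛ.idem e hr.mem
  have hcomm := fun w => (mem_parabolic_typeMap hΛ hr.mem w).1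
  -- Since wC = wN wD, the middle factor is w₀ wC d = 1 · (w₀ wN) · (wD d).
  refine ⟨?_, hr.mem, ⟨e, hr.mem, rfl⟩, ?_, ?_, mem_minReps_empty_right_iff.2 hr.right,
    mem_minReps_empty_left_iff.2
      (hr.left.mul_longest (mem_parabolic_typeMap_conjLongest e) hC),
    longest cs * wN, isMinRep_longest_mul (mem_parabolic_lowerType_conjLongest e) hN,
    1, one_mem _, wD * d, mul_mem hD.mem hr.mid, ?_⟩
  · rw [hr.eq]
    have h1 : (vanillaData cs wC x₀ d e y).σm * (longest cs) = x₀ * wC := by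
      simp only [vanillaData, mul_assoc, longest_mul_self, mul_one]
    have h2 : longest cs * (vanillaData cs wC x₀ d e y).σz = wC * d := by
      simp only [vanillaData, mul_assoc, longest_mul_cancel_left]
    have h3 : ((vanillaData cs wC x₀ d e y).σm : R) * (vanillaData cs wC x₀ d e y).em *
        (vanillaData cs wC x₀ d e y).σz = ((x₀ * wC : Rˣ) : R) * e * ((wC * d : Rˣ) : R) := by
      rw [← h1, ← h2]
      simp only [vanillaData, conjLongest, Units.val_mul, mul_assoc]
    rw [h3]
    change _ = _ * e * (y : R)
    have h4 := hcomm _ (mul_mem hC.mem (parabolic_upperType_le cs e hr.mid))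
    have h5 : x₀ * d = x₀ * wC * (wC * d) := by
      rw [mul_assoc, ← mul_assoc wC, hC.mul_self, one_mul]
    have h6 : ((x₀ * wC : Rˣ) : R) * e * ((wC * d : Rˣ) : R) * e = ((x₀ * d : Rˣ) : R) * e := by
      rw [mul_assoc, h4, mul_assoc _ e, ← mul_assoc e, hi.eq, ← h4, h5, Units.val_mul _ (wC * d),
        mul_assoc]
    rw [h6]
  · exact (greenJ_units _ _ _).trans (hr.eq ▸ greenJ_units _ _ _).symm
  · exact hr.eq ▸ greenJ_units _ _ _
  · simp only [vanillaData, one_mul, isLongest_eq_mul hΛ hr.mem hC hD hN, mul_assoc]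

include hΛ in
-- Converse of the rewriting, from which uniqueness of vanilla forms follows: 𝓙-equivalence makes e₋
-- and e₊ conjugate under w₀, and x₀ = σ₋ w₀ wC.
theorem IsVanillaForm.exists_isNormalForm {δ : VanillaData R} (h : IsVanillaForm cs Λ r δ) :
    ∃ x₀ d e y, IsNormalForm cs Λ r x₀ d e y ∧
      ∀ wC, IsLongest cs (typeMap cs e) wC → δ = vanillaData cs wC x₀ d e y := by
  obtain ⟨σm, em, σz, e, y⟩ := δ
  obtain ⟨heq, he, ⟨f, hf, hem⟩, h1, h2, hy, hm, n, hn, a, ha, b, hb, hz⟩ := h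
  simp only at *
  change em = conjLongest cs f at hem
  subst hem hz
  have hfe : f = e := by
    obtain ⟨u, hu⟩ := hΛ.factorizable.exists_conj_eq_of_greenJ (hΛ.idem f hf) (hΛ.idem e he)
      ((greenJ_units (longest cs) (longest cs) f).symm.trans (h1.trans h2))
    exact (hΛ.eq_of_conj he hf hu).symm
  subst hfe
  obtain ⟨wC, hC⟩ := exists_isLongest cs (typeMap cs f)
  obtain ⟨wN, hN⟩ := exists_isLongest cs (lowerType cs f)
  obtain ⟨wD, hD⟩ := exists_isLongest cs (upperType cs f)
  rw [(isMinRep_longest_mul (mem_parabolic_lowerType_conjLongest f) hN).iff_eq] at hn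
  subst hn
  rw [mem_parabolic_upperType_conjLongest] at ha
  rw [mem_minReps_empty_left_iff] at hm
  -- Carried across w₀, the factor a becomes an element of W_{λ^*(e)}, which commutes with wN = wC
  -- wD; this isolates d.
  have hσz : a * (longest cs * wN) * b =
      longest cs * wC * (wD * (longest cs * a * longest cs) * b) := by
    have hc := (isProductPair_upperType_lowerType hΛ hf).commute _ ha _ hN.mem
    have h3 : a * (longest cs * wN) * b =
        longest cs * (longest cs * a * longest cs * wN) * b := by
      simp only [mul_assoc, longest_mul_cancel_left]
    have h4 : wC * wD = wN := by
      rw [isLongest_eq_mul hΛ hf hC hD hN, mul_assoc, hD.mul_self, mul_one]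
    rw [h3, hc.eq, ← h4]
    simp only [mul_assoc]
  rw [hσz] at heq ⊢
  have hd : wD * (longest cs * a * longest cs) * b ∈ parabolic cs (upperType cs f) :=
    mul_mem (mul_mem hD.mem ha) hb
  generalize wD * (longest cs * a * longest cs) * b = d at *
  refine ⟨σm * longest cs * wC, d, f, y, ⟨?_, hf, ?_, hd, mem_minReps_empty_right_iff.1 hy⟩, ?_⟩
  · have hcomm := (mem_parabolic_typeMap hΛ hf _).1
      (mul_mem hC.mem (parabolic_upperType_le cs f hd))
    have h5 : (σm : R) * conjLongest cs f * ((longest cs * wC * d : Rˣ) : R) * f =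
        ((σm * longest cs : Rˣ) : R) * (f * ((wC * d : Rˣ) : R) * f) := by
      simp only [conjLongest, Units.val_mul, mul_assoc, longest_mul_cancel_left_val]
    rw [heq, h5, ← hcomm, mul_assoc _ f f, (hΛ.idem f hf).eq]
    simp only [Units.val_mul, mul_assoc]
  -- The longest element attached to e₋ is w₀ wC w₀, and σ₋ (w₀ wC w₀) w₀ = σ₋ w₀ wC.
  · have := hm.mul_longest (J' := typeMap cs f) (fun v => by
      rw [mem_parabolic_typeMap_conjLongest]
      simp only [mul_assoc, longest_mul_cancel_left, longest_mul_self, mul_one])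
      (isLongest_conjLongest hC)
    simpa only [mul_assoc, longest_mul_self, mul_one] using this
  · intro wC' hC'
    obtain rfl := hC.eq_of_length_le hC'.mem (hC'.length_le _ hC.mem)
    simp only [vanillaData, mul_assoc]
    rw [← mul_assoc wC' wC', hC.mul_self, one_mul, longest_mul_self, mul_one]

include hΛ in
theorem existsUnique_isVanillaForm (r : R) : ∃! δ, IsVanillaForm cs Λ r δ := by
  obtain ⟨x₀, d, e, y, hr⟩ := hΛ.exists_isNormalForm r
  obtain ⟨wC, hC⟩ := exists_isLongest cs (typeMap cs e)
  refine ⟨_, hr.isVanillaForm hΛ hC, fun δ hδ => ?_⟩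
  obtain ⟨x₀', d', e', y', hr', h⟩ := hδ.exists_isNormalForm hΛ
  obtain ⟨rfl, rfl, rfl, rfl⟩ := hr.unique hΛ hr'
  exact h wC hC

include hΛ in
theorem existsUnique_extremal_plus (r : R) :
    (∃! m, IsAbsMin cs Λ Sign.plus GreenH r m) ∧ (∃! m, IsAbsMax cs Λ Sign.plus GreenH r m) ∧
    (∃! m, IsAbsMin cs Λ Sign.plus GreenL r m) ∧ (∃! m, IsAbsMax cs Λ Sign.plus GreenL r m) ∧
    (∃! m, IsAbsMin cs Λ Sign.plus GreenR r m) ∧ (∃! m, IsAbsMax cs Λ Sign.plus GreenR r m) ∧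
    (∃! m, IsAbsMin cs Λ Sign.plus GreenJ r m) ∧
    (∃! m, IsAbsMax cs Λ Sign.plus GreenJ r m) := by
  obtain ⟨x₀, d, e, y, hr⟩ := hΛ.exists_isNormalForm r
  obtain ⟨wC, hC⟩ := exists_isLongest cs (typeMap cs e)
  obtain ⟨wD, hD⟩ := exists_isLongest cs (upperType cs e)
  have kmin : ∀ {T : R → R → Prop} {m : R}, IsAbsMin cs Λ Sign.plus T r m →
      ∃! m, IsAbsMin cs Λ Sign.plus T r m := fun h => ⟨_, h, fun _ h' => h'.unique hΛ h⟩
  have kmax : ∀ {T : R → R → Prop} {m : R}, IsAbsMax cs Λ Sign.plus T r m →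
      ∃! m, IsAbsMax cs Λ Sign.plus T r m := fun h => ⟨_, h, fun _ h' => h'.unique hΛ h⟩
  exact ⟨kmin (hr.isAbsMin_greenH hΛ), kmax (hr.isAbsMax_greenH hΛ hD),
    kmin (hr.isAbsMin_greenL hΛ), kmax (hr.isAbsMax_greenL hΛ hC hD),
    kmin (hr.isAbsMin_greenR hΛ hC), kmax (hr.isAbsMax_greenR hΛ hD),
    kmin (hr.isAbsMin_greenJ hΛ hC), kmax (hr.isAbsMax_greenJ hΛ hC hD)⟩

omit [Finite R] in
include hΛ in
theorem IsNormalForm.eq_iff {x₀' d' y' : Rˣ} (hr : IsNormalForm cs Λ r x₀ d e y)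
    (hm : IsNormalForm cs Λ ((x₀' * d' : Rˣ) * e * y') x₀' d' e y') :
    r = (x₀' * d' : Rˣ) * e * y' ↔ x₀ = x₀' ∧ d = d' ∧ y = y' := by
  constructor
  · rintro h
    rw [← h] at hm
    obtain ⟨h1, h2, -, h3⟩ := hr.unique hΛ hm
    exact ⟨h1, h2, h3⟩
  · rintro ⟨rfl, rfl, rfl⟩
    exact hr.eq

include hΛ in
theorem extremal_iff_plus {r : R} {δ : VanillaData R} (h : IsVanillaForm cs Λ r δ) :
    (IsAbsMin cs Λ Sign.plus GreenH r r ↔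
      IsMinRep cs (typeMap cs δ.em) (typeMap cs δ.ep) (longest cs) δ.σz) ∧
    (IsAbsMin cs Λ Sign.plus GreenL r r ↔
      IsMinRep cs (typeMap cs δ.ep) (typeMap cs δ.em) (longest cs) δ.σm ∧
      IsMinRep cs (typeMap cs δ.em) (typeMap cs δ.ep) (longest cs) δ.σz) ∧
    (IsAbsMin cs Λ Sign.plus GreenR r r ↔
      IsMinRep cs (typeMap cs δ.em) (typeMap cs δ.ep) (longest cs) δ.σz ∧
      IsMinRep cs (typeMap cs δ.ep) (typeMap cs δ.em) (longest cs) δ.σp) ∧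
    (IsAbsMin cs Λ Sign.plus GreenJ r r ↔
      IsMinRep cs (typeMap cs δ.ep) (typeMap cs δ.em) (longest cs) δ.σm ∧
      IsMinRep cs (typeMap cs δ.em) (typeMap cs δ.ep) (longest cs) δ.σz ∧
      IsMinRep cs (typeMap cs δ.ep) (typeMap cs δ.em) (longest cs) δ.σp) ∧
    (IsAbsMax cs Λ Sign.plus GreenH r r ↔
      IsMinRep cs (lowerType cs δ.em) (lowerType cs δ.ep) (longest cs) δ.σz) ∧
    (IsAbsMax cs Λ Sign.plus GreenL r r ↔
      δ.σm = 1 ∧ IsMinRep cs (lowerType cs δ.em) (lowerType cs δ.ep) (longest cs) δ.σz) ∧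
    (IsAbsMax cs Λ Sign.plus GreenR r r ↔
      IsMinRep cs (lowerType cs δ.em) (lowerType cs δ.ep) (longest cs) δ.σz ∧ δ.σp = 1) ∧
    (IsAbsMax cs Λ Sign.plus GreenJ r r ↔
      δ.σm = 1 ∧ IsMinRep cs (lowerType cs δ.em) (lowerType cs δ.ep) (longest cs) δ.σz ∧
      δ.σp = 1) := by
  obtain ⟨x₀, d, e, y, hr, hδ⟩ := h.exists_isNormalForm hΛ
  obtain ⟨wC, hC⟩ := exists_isLongest cs (typeMap cs e)
  obtain ⟨wN, hN⟩ := exists_isLongest cs (lowerType cs e)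
  obtain ⟨wD, hD⟩ := exists_isLongest cs (upperType cs e)
  obtain rfl := hδ wC hC
  have hconj := mem_parabolic_typeMap_conjLongest (cs := cs) e
  have hCN : wC * wD = wN := by
    rw [isLongest_eq_mul hΛ hr.mem hC hD hN, mul_assoc, hD.mul_self, mul_one]
  have c1 : IsMinRep cs (typeMap cs (conjLongest cs e)) (typeMap cs e) (longest cs)
      (longest cs * wC * d) ↔ d = 1 := by
    rw [(isMinRep_longest_mul hconj hC).iff_eq, mul_eq_left]
  have c2 : IsMinRep cs (lowerType cs (conjLongest cs e)) (lowerType cs e) (longest cs)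
      (longest cs * wC * d) ↔ d = wD := by
    rw [(isMinRep_longest_mul (mem_parabolic_lowerType_conjLongest e) hN).iff_eq, ← hCN,
      ← mul_assoc, mul_right_inj]
  have c3 : IsMinRep cs (typeMap cs e) (typeMap cs (conjLongest cs e)) (longest cs)
      (x₀ * wC * longest cs) ↔ x₀ = 1 := by
    rw [(isMinRep_mul_longest hconj hC).iff_eq, mul_left_inj, mul_eq_right]
  have c4 : x₀ * wC * longest cs = 1 ↔ x₀ = longest cs * wC := by
    rw [mul_assoc, mul_eq_one_iff_eq_inv, mul_inv_rev, longest_inv, hC.inv_eq]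
  have c5 : IsMinRep cs (typeMap cs e) (typeMap cs (conjLongest cs e)) (longest cs) y ↔
      y = wC * longest cs := (isMinRep_mul_longest hconj hC).iff_eq
  have hmax := hC.longest_mul
  have hyw := cosetMin_inv_mul_longest hC
  have hy1 : CosetMin cs (typeMap cs e) (1 : Rˣ)⁻¹ := by simpa using cosetMin_one
  have h1D := one_mem (parabolic cs (upperType cs e))
  simp only [vanillaData, c1, c2, c3, c4, c5]
  refine ⟨?_, ?_, ?_, ?_, ?_, ?_, ?_, ?_⟩
  · rw [(hr.isAbsMin_greenH hΛ).self_iff hΛ, hr.eq_iff hΛ (hr.change hr.left h1D hr.right)]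
    exact ⟨fun h => h.2.1, fun h => ⟨rfl, h, rfl⟩⟩
  · rw [(hr.isAbsMin_greenL hΛ).self_iff hΛ, hr.eq_iff hΛ (hr.change cosetMin_one h1D hr.right)]
    exact ⟨fun h => ⟨h.1, h.2.1⟩, fun h => ⟨h.1, h.2, rfl⟩⟩
  · rw [(hr.isAbsMin_greenR hΛ hC).self_iff hΛ, hr.eq_iff hΛ (hr.change hr.left h1D hyw)]
    exact ⟨fun h => h.2, fun h => ⟨rfl, h⟩⟩
  · rw [(hr.isAbsMin_greenJ hΛ hC).self_iff hΛ, hr.eq_iff hΛ (hr.change cosetMin_one h1D hyw)]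
  · rw [(hr.isAbsMax_greenH hΛ hD).self_iff hΛ, hr.eq_iff hΛ (hr.change hr.left hD.mem hr.right)]
    exact ⟨fun h => h.2.1, fun h => ⟨rfl, h, rfl⟩⟩
  · rw [(hr.isAbsMax_greenL hΛ hC hD).self_iff hΛ, hr.eq_iff hΛ (hr.change hmax hD.mem hr.right)]
    exact ⟨fun h => ⟨h.1, h.2.1⟩, fun h => ⟨h.1, h.2, rfl⟩⟩
  · rw [(hr.isAbsMax_greenR hΛ hD).self_iff hΛ, hr.eq_iff hΛ (hr.change hr.left hD.mem hy1)]
    exact ⟨fun h => h.2, fun h => ⟨rfl, h⟩⟩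
  · rw [(hr.isAbsMax_greenJ hΛ hC hD).self_iff hΛ, hr.eq_iff hΛ (hr.change hmax hD.mem hy1)]

end VanillaPlus

/-! ### Inversion in the inverse monoid R. -/

section Inverse

variable {R : Type*} [Monoid R]

/-- `s` is a generalized inverse of `r`. -/
def IsGenInverse (r s : R) : Prop := r * s * r = r ∧ s * r * s = s

theorem IsGenInverse.symm {r s : R} (h : IsGenInverse r s) : IsGenInverse s r := ⟨h.2, h.1⟩

theorem IsGenInverse.idem {r s : R} (h : IsGenInverse r s) : IsIdempotentElem (r * s) := by
  unfold IsIdempotentElem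
  rw [← mul_assoc, h.1]

variable (hR : IsFactorizable R)
include hR

/-- Commuting idempotents twice, once for the products sr, tr and once for rs, rt, converts s into
t. -/
theorem IsGenInverse.unique {r s t : R} (h : IsGenInverse r s) (h' : IsGenInverse r t) :
    s = t := by
  have c1 := hR.idem_comm _ _ h.symm.idem h'.symm.idem
  have c2 := hR.idem_comm _ _ h.idem h'.idem
  calc s = s * r * s := h.2.symm
    _ = s * (r * t * r) * s := by rw [h'.1]
    _ = s * r * (t * r) * s := by simp only [mul_assoc]
    _ = t * r * (s * r) * s := by rw [c1]
    _ = t * (r * s * r) * s := by simp only [mul_assoc]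
    _ = t * r * s := by rw [h.1]
    _ = t * r * t * r * s := by rw [h'.2]
    _ = t * (r * t * (r * s)) := by simp only [mul_assoc]
    _ = t * (r * s * (r * t)) := by rw [c2]
    _ = t * (r * s * r) * t := by simp only [mul_assoc]
    _ = t := by rw [h.1, h'.2]

theorem IsGenInverse.mul {r s r' s' : R} (h : IsGenInverse r s) (h' : IsGenInverse r' s') :
    IsGenInverse (r * r') (s' * s) := by
  have c := hR.idem_comm _ _ h.symm.idem h'.idem
  constructor
  · calc r * r' * (s' * s) * (r * r') = r * (r' * s' * (s * r)) * r' := by simp only [mul_assoc]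
      _ = r * (s * r * (r' * s')) * r' := by rw [c]
      _ = r * s * r * (r' * s' * r') := by simp only [mul_assoc]
      _ = r * r' := by rw [h.1, h'.1]
  · calc s' * s * (r * r') * (s' * s) = s' * (s * r * (r' * s')) * s := by simp only [mul_assoc]
      _ = s' * (r' * s' * (s * r)) * s := by rw [c]
      _ = s' * r' * s' * (s * r * s) := by simp only [mul_assoc]
      _ = s' * s := by rw [h.2, h'.2]

omit hR in
theorem isGenInverse_unit (w : Rˣ) : IsGenInverse (w : R) (w⁻¹ : Rˣ) := by
  simp [IsGenInverse]

omit hR in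
theorem isGenInverse_idem {e : R} (he : IsIdempotentElem e) : IsGenInverse e e := by
  simp [IsGenInverse, he.eq]

theorem IsFactorizable.exists_isGenInverse (r : R) : ∃ s, IsGenInverse r s := by
  obtain ⟨e, he, w, rfl⟩ := hR.exists_idem_mul_unit r
  exact ⟨_, (isGenInverse_idem he).mul hR (isGenInverse_unit w)⟩

/-- The inverse in the inverse monoid `R`. -/
noncomputable def IsFactorizable.genInv (r : R) : R := Classical.choose (hR.exists_isGenInverse r)

theorem IsFactorizable.isGenInverse_genInv (r : R) : IsGenInverse r (hR.genInv r) :=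
  Classical.choose_spec (hR.exists_isGenInverse r)

theorem IsFactorizable.genInv_genInv (r : R) : hR.genInv (hR.genInv r) = r :=
  (hR.isGenInverse_genInv _).unique hR (hR.isGenInverse_genInv r).symm

theorem IsFactorizable.genInv_mul (r s : R) : hR.genInv (r * s) = hR.genInv s * hR.genInv r :=
  (hR.isGenInverse_genInv _).unique hR
    ((hR.isGenInverse_genInv r).mul hR (hR.isGenInverse_genInv s))

theorem IsFactorizable.genInv_unit (w : Rˣ) : hR.genInv (w : R) = (w⁻¹ : Rˣ) :=
  (hR.isGenInverse_genInv _).unique hR (isGenInverse_unit w)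

theorem IsFactorizable.genInv_idem {e : R} (he : IsIdempotentElem e) : hR.genInv e = e :=
  (hR.isGenInverse_genInv _).unique hR (isGenInverse_idem he)

theorem IsFactorizable.genInv_injective : Function.Injective hR.genInv :=
  Function.LeftInverse.injective hR.genInv_genInv

theorem IsFactorizable.greenL_iff_genInv {r s : R} :
    GreenL r s ↔ GreenR (hR.genInv r) (hR.genInv s) := by
  have key : ∀ r s : R, (∃ p, r = p * s) ↔ ∃ p, hR.genInv r = hR.genInv s * p := by
    intro r s
    constructor
    · rintro ⟨p, h⟩
      exact ⟨hR.genInv p, by rw [h, hR.genInv_mul]⟩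
    · rintro ⟨p, h⟩
      refine ⟨hR.genInv p, hR.genInv_injective ?_⟩
      rw [h, hR.genInv_mul, hR.genInv_genInv]
  rw [greenL_iff, greenR_iff, key r s, key s r]

theorem IsFactorizable.greenR_iff_genInv {r s : R} :
    GreenR r s ↔ GreenL (hR.genInv r) (hR.genInv s) := by
  rw [hR.greenL_iff_genInv, hR.genInv_genInv, hR.genInv_genInv]

theorem IsFactorizable.greenH_iff_genInv {r s : R} :
    GreenH r s ↔ GreenH (hR.genInv r) (hR.genInv s) := by
  exact ⟨fun h => ⟨hR.greenR_iff_genInv.1 h.2, hR.greenL_iff_genInv.1 h.1⟩,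
    fun h => ⟨hR.greenL_iff_genInv.2 h.2, hR.greenR_iff_genInv.2 h.1⟩⟩

theorem IsFactorizable.greenJ_genInv {r s : R} (h : GreenJ r s) :
    GreenJ (hR.genInv r) (hR.genInv s) := by
  obtain ⟨⟨p, q, h1⟩, p', q', h2⟩ := greenJ_iff.1 h
  refine greenJ_iff.2 ⟨⟨hR.genInv q, hR.genInv p, ?_⟩, hR.genInv q', hR.genInv p', ?_⟩
  · rw [h1, hR.genInv_mul, hR.genInv_mul, mul_assoc]
  · rw [h2, hR.genInv_mul, hR.genInv_mul, mul_assoc]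

theorem IsFactorizable.greenJ_iff_genInv {r s : R} :
    GreenJ r s ↔ GreenJ (hR.genInv r) (hR.genInv s) :=
  ⟨hR.greenJ_genInv, fun h => by
    simpa only [hR.genInv_genInv] using hR.greenJ_genInv h⟩

end Inverse

/-! ### Transfer from ≤⁺ to ≤⁻ by inversion. -/

section Minus

variable {B R : Type*} [Monoid R] {M : CoxeterMatrix B} {cs : CoxeterSystem M Rˣ} {Λ : Set R}
  (hΛ : IsRennerCoxeterSystem cs Λ)
include hΛ

theorem IsRennerCoxeterSystem.genInv_standard {e : R} (he : e ∈ Λ) (x y : Rˣ) :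
    hΛ.factorizable.genInv (x * e * y) = (y⁻¹ : Rˣ) * e * (x⁻¹ : Rˣ) := by
  rw [hΛ.factorizable.genInv_mul, hΛ.factorizable.genInv_mul, hΛ.factorizable.genInv_unit,
    hΛ.factorizable.genInv_unit, hΛ.factorizable.genInv_idem (hΛ.idem e he), mul_assoc]

theorem isRightStandardForm_iff {r e : R} {x y : Rˣ} :
    IsRightStandardForm cs Λ r y e x ↔
      IsLeftStandardForm cs Λ (hΛ.factorizable.genInv r) x⁻¹ e y⁻¹ := by
  unfold IsRightStandardForm IsLeftStandardForm
  rw [mem_minReps_inv_iff, mem_minReps_inv_iff]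
  refine and_congr_left fun h => ?_
  rw [← hΛ.factorizable.genInv_injective.eq_iff, hΛ.genInv_standard h.1]

/-- Inversion preserves the Bruhat order and sends r = yex to x⁻¹ey⁻¹, exchanging the two standard
forms; the element w is replaced by w⁻¹. -/
theorem adhMinus_iff {r s : R} :
    AdhMinus cs Λ r s ↔
      AdhPlus cs Λ (hΛ.factorizable.genInv r) (hΛ.factorizable.genInv s) := by
  constructor
  · rintro ⟨y, e, x, b, f, a, hr, hs, hef, v, hv, u, hu, h1, h2⟩
    refine ⟨_, _, _, _, _, _, (isRightStandardForm_iff hΛ).1 hr, (isRightStandardForm_iff hΛ).1 hs,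
      hef, u⁻¹, inv_mem hu, v⁻¹, inv_mem hv, ?_, ?_⟩
    · simpa only [mul_inv_rev] using h1.inv
    · simpa only [mul_inv_rev, inv_inv] using h2.inv
  · rintro ⟨x, e, y, a, f, b, hr, hs, hef, u, hu, v, hv, h1, h2⟩
    refine ⟨y⁻¹, e, x⁻¹, b⁻¹, f, a⁻¹, (isRightStandardForm_iff hΛ).2 (by simpa using hr),
      (isRightStandardForm_iff hΛ).2 (by simpa using hs), hef, v⁻¹, inv_mem hv, u⁻¹, inv_mem hu,
      ?_, ?_⟩
    · simpa only [mul_inv_rev] using h1.inv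
    · simpa only [mul_inv_rev, inv_inv] using h2.inv

variable {T T' : R → R → Prop}
  (hT : ∀ {a b : R}, T a b ↔ T' (hΛ.factorizable.genInv a) (hΛ.factorizable.genInv b)) {r m : R}
include hT

theorem isAbsMin_minus_iff : IsAbsMin cs Λ Sign.minus T r m ↔
    IsAbsMin cs Λ Sign.plus T' (hΛ.factorizable.genInv r) (hΛ.factorizable.genInv m) := by
  refine and_congr hT ⟨fun h t ht => ?_, fun h t ht => (adhMinus_iff hΛ).2 (h _ (hT.1 ht))⟩
  have := (adhMinus_iff hΛ).1
    (h (hΛ.factorizable.genInv t) (hT.2 (by rwa [hΛ.factorizable.genInv_genInv])))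
  rwa [hΛ.factorizable.genInv_genInv] at this

theorem isAbsMax_minus_iff : IsAbsMax cs Λ Sign.minus T r m ↔
    IsAbsMax cs Λ Sign.plus T' (hΛ.factorizable.genInv r) (hΛ.factorizable.genInv m) := by
  refine and_congr hT ⟨fun h t ht => ?_, fun h t ht => (adhMinus_iff hΛ).2 (h _ (hT.1 ht))⟩
  have := (adhMinus_iff hΛ).1
    (h (hΛ.factorizable.genInv t) (hT.2 (by rwa [hΛ.factorizable.genInv_genInv])))
  rwa [hΛ.factorizable.genInv_genInv] at this

theorem existsUnique_isAbsMin_minus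
    (h : ∃! m, IsAbsMin cs Λ Sign.plus T' (hΛ.factorizable.genInv r) m) :
    ∃! m, IsAbsMin cs Λ Sign.minus T r m := by
  obtain ⟨m, hm, hu⟩ := h
  refine ⟨hΛ.factorizable.genInv m, (isAbsMin_minus_iff hΛ hT).2 ?_, fun m' hm' => ?_⟩
  · rwa [hΛ.factorizable.genInv_genInv]
  · rw [← hu _ ((isAbsMin_minus_iff hΛ hT).1 hm'), hΛ.factorizable.genInv_genInv]

theorem existsUnique_isAbsMax_minus
    (h : ∃! m, IsAbsMax cs Λ Sign.plus T' (hΛ.factorizable.genInv r) m) :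
    ∃! m, IsAbsMax cs Λ Sign.minus T r m := by
  obtain ⟨m, hm, hu⟩ := h
  refine ⟨hΛ.factorizable.genInv m, (isAbsMax_minus_iff hΛ hT).2 ?_, fun m' hm' => ?_⟩
  · rwa [hΛ.factorizable.genInv_genInv]
  · rw [← hu _ ((isAbsMax_minus_iff hΛ hT).1 hm'), hΛ.factorizable.genInv_genInv]

end Minus

/-! ### Vanilla forms over the opposite lattice. -/

section VanillaMinus

variable {B R : Type*} [Monoid R] [Finite R] {M : CoxeterMatrix B} {cs : CoxeterSystem M Rˣ}
  {Λ : Set R}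

/-- The data of the vanilla form of the inverse element. -/
def VanillaData.inv {R : Type*} [Monoid R] (δ : VanillaData R) : VanillaData R :=
  ⟨δ.σp⁻¹, δ.ep, δ.σz⁻¹, δ.em, δ.σm⁻¹⟩

theorem VanillaData.inv_inv {R : Type*} [Monoid R] (δ : VanillaData R) : δ.inv.inv = δ := by
  simp [VanillaData.inv]

theorem opposite_opposite : opposite cs (opposite cs Λ) = Λ := by
  ext e
  constructor
  · rintro ⟨_, ⟨f, hf, rfl⟩, rfl⟩
    have : _ = f := conjLongest_conjLongest (cs := cs) f
    rw [← this] at hf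
    exact hf
  · intro he
    exact ⟨_, ⟨e, he, rfl⟩, (conjLongest_conjLongest (cs := cs) e).symm⟩

theorem isMinRep_longest_inv_iff {I J : Set B} {m : Rˣ} :
    IsMinRep cs I J (longest cs) m⁻¹ ↔ IsMinRep cs J I (longest cs) m := by
  rw [← isMinRep_inv_iff (I := J), longest_inv]

variable (hΛ : IsRennerCoxeterSystem cs Λ)
include hΛ

theorem isIdempotentElem_of_mem_opposite {e : R} (he : e ∈ opposite cs Λ) :
    IsIdempotentElem e := by
  obtain ⟨f, hf, rfl⟩ := he
  have := isIdempotentElem_conj (hΛ.idem f hf) (longest cs)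
  rwa [longest_inv] at this

omit [Finite R] in
theorem genInv_vanilla {δ : VanillaData R} (hm : IsIdempotentElem δ.em)
    (hp : IsIdempotentElem δ.ep) :
    hΛ.factorizable.genInv (δ.σm * δ.em * δ.σz * δ.ep * δ.σp) =
      δ.inv.σm * δ.inv.em * δ.inv.σz * δ.inv.ep * δ.inv.σp := by
  simp only [hΛ.factorizable.genInv_mul, hΛ.factorizable.genInv_unit,
    hΛ.factorizable.genInv_idem hm, hΛ.factorizable.genInv_idem hp, VanillaData.inv, mul_assoc]

/-- Reversing the five factors exchanges e₋ and e₊, hence Λ and w₀Λw₀. The double coset condition on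
σ₀ is stable because w₀ is an involution. -/
theorem isVanillaForm_opposite_iff {r : R} {δ : VanillaData R} :
    IsVanillaForm cs (opposite cs Λ) r δ ↔
      IsVanillaForm cs Λ (hΛ.factorizable.genInv r) δ.inv := by
  constructor
  · rintro ⟨h1, h2, h3, h4, h5, h6, h7, m, hm, a, ha, b, hb, hz⟩
    rw [opposite_opposite] at h3
    have hem := hΛ.idem _ h3
    have hep := isIdempotentElem_of_mem_opposite hΛ h2
    refine ⟨?_, h3, h2, ?_, ?_, mem_minReps_inv_iff.2 h7, mem_minReps_inv_iff.2 h6, m⁻¹,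
      isMinRep_longest_inv_iff.2 hm, b⁻¹, inv_mem hb, a⁻¹, inv_mem ha, ?_⟩
    · rw [h1, genInv_vanilla hΛ hem hep]
    · have := hΛ.factorizable.greenJ_genInv h5.symm
      rwa [hΛ.factorizable.genInv_idem hep] at this
    · have := hΛ.factorizable.greenJ_genInv h4.symm
      rwa [hΛ.factorizable.genInv_idem hem] at this
    · simp [VanillaData.inv, hz, mul_assoc]
  · rintro ⟨h1, h2, h3, h4, h5, h6, h7, m, hm, a, ha, b, hb, hz⟩
    have hem : IsIdempotentElem δ.em := hΛ.idem _ h2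
    have hep : IsIdempotentElem δ.ep := isIdempotentElem_of_mem_opposite hΛ h3
    refine ⟨?_, h3, by rwa [opposite_opposite], ?_, ?_, mem_minReps_inv_iff.1 h7,
      mem_minReps_inv_iff.1 h6, m⁻¹, isMinRep_longest_inv_iff.2 hm, b⁻¹, inv_mem hb, a⁻¹,
      inv_mem ha, ?_⟩
    · rw [← hΛ.factorizable.genInv_injective.eq_iff, h1, genInv_vanilla hΛ hem hep]
    · have := hΛ.factorizable.greenJ_genInv h5.symm
      rw [hΛ.factorizable.genInv_genInv] at this
      change GreenJ (hΛ.factorizable.genInv δ.em) r at this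
      rwa [hΛ.factorizable.genInv_idem hem] at this
    · have := hΛ.factorizable.greenJ_genInv h4.symm
      rw [hΛ.factorizable.genInv_genInv] at this
      change GreenJ r (hΛ.factorizable.genInv δ.ep) at this
      rwa [hΛ.factorizable.genInv_idem hep] at this
    · have : δ.σz = (a * m * b)⁻¹ := by rw [← hz]; simp [VanillaData.inv]
      rw [this]
      simp [mul_assoc]

end VanillaMinus

end RennerCoxeter

theorem mainTheorem3 {B R : Type*} [Monoid R] [Finite R] {M : CoxeterMatrix B}
    (cs : CoxeterSystem M Rˣ) (Λ : Set R) (hΛ : IsRennerCoxeterSystem cs Λ) (ε : Sign) :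
    (∀ r : R,
      (∃! m, IsAbsMin cs Λ ε GreenH r m) ∧ (∃! m, IsAbsMax cs Λ ε GreenH r m) ∧
      (∃! m, IsAbsMin cs Λ ε GreenL r m) ∧ (∃! m, IsAbsMax cs Λ ε GreenL r m) ∧
      (∃! m, IsAbsMin cs Λ ε GreenR r m) ∧ (∃! m, IsAbsMax cs Λ ε GreenR r m) ∧
      (∃! m, IsAbsMin cs Λ ε GreenJ r m) ∧ (∃! m, IsAbsMax cs Λ ε GreenJ r m)) ∧
    (∀ r : R, ∃! d : VanillaData R, IsVanillaForm cs (crossSection cs Λ ε) r d) ∧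
    (∀ (r : R) (d : VanillaData R), IsVanillaForm cs (crossSection cs Λ ε) r d →
      (IsAbsMin cs Λ ε GreenH r r ↔
        IsMinRep cs (typeMap cs d.em) (typeMap cs d.ep) (longest cs) d.σz) ∧
      (IsAbsMin cs Λ ε GreenL r r ↔
        IsMinRep cs (typeMap cs d.ep) (typeMap cs d.em) (longest cs) d.σm ∧
        IsMinRep cs (typeMap cs d.em) (typeMap cs d.ep) (longest cs) d.σz) ∧
      (IsAbsMin cs Λ ε GreenR r r ↔
        IsMinRep cs (typeMap cs d.em) (typeMap cs d.ep) (longest cs) d.σz ∧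
        IsMinRep cs (typeMap cs d.ep) (typeMap cs d.em) (longest cs) d.σp) ∧
      (IsAbsMin cs Λ ε GreenJ r r ↔
        IsMinRep cs (typeMap cs d.ep) (typeMap cs d.em) (longest cs) d.σm ∧
        IsMinRep cs (typeMap cs d.em) (typeMap cs d.ep) (longest cs) d.σz ∧
        IsMinRep cs (typeMap cs d.ep) (typeMap cs d.em) (longest cs) d.σp) ∧
      (IsAbsMax cs Λ ε GreenH r r ↔
        IsMinRep cs (lowerType cs d.em) (lowerType cs d.ep) (longest cs) d.σz) ∧
      (IsAbsMax cs Λ ε GreenL r r ↔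
        d.σm = 1 ∧ IsMinRep cs (lowerType cs d.em) (lowerType cs d.ep) (longest cs) d.σz) ∧
      (IsAbsMax cs Λ ε GreenR r r ↔
        IsMinRep cs (lowerType cs d.em) (lowerType cs d.ep) (longest cs) d.σz ∧ d.σp = 1) ∧
      (IsAbsMax cs Λ ε GreenJ r r ↔
        d.σm = 1 ∧ IsMinRep cs (lowerType cs d.em) (lowerType cs d.ep) (longest cs) d.σz ∧
        d.σp = 1)) := by
  cases ε with
  | plus =>
    exact ⟨existsUnique_extremal_plus hΛ, existsUnique_isVanillaForm hΛ,
      fun r δ h => extremal_iff_plus hΛ h⟩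
  | minus =>
    have tH := fun {a b : R} => hΛ.factorizable.greenH_iff_genInv (r := a) (s := b)
    have tL := fun {a b : R} => hΛ.factorizable.greenL_iff_genInv (r := a) (s := b)
    have tR := fun {a b : R} => hΛ.factorizable.greenR_iff_genInv (r := a) (s := b)
    have tJ := fun {a b : R} => hΛ.factorizable.greenJ_iff_genInv (r := a) (s := b)
    refine ⟨fun r => ?_, fun r => ?_, fun r δ h => ?_⟩
    · obtain ⟨h1, h2, h3, h4, h5, h6, h7, h8⟩ :=
        existsUnique_extremal_plus hΛ (hΛ.factorizable.genInv r)
      exact ⟨existsUnique_isAbsMin_minus hΛ tH h1, existsUnique_isAbsMax_minus hΛ tH h2,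
        existsUnique_isAbsMin_minus hΛ tL h5, existsUnique_isAbsMax_minus hΛ tL h6,
        existsUnique_isAbsMin_minus hΛ tR h3, existsUnique_isAbsMax_minus hΛ tR h4,
        existsUnique_isAbsMin_minus hΛ tJ h7, existsUnique_isAbsMax_minus hΛ tJ h8⟩
    · obtain ⟨δ, hδ, hu⟩ := existsUnique_isVanillaForm hΛ (hΛ.factorizable.genInv r)
      refine ⟨δ.inv, (isVanillaForm_opposite_iff hΛ).2 (by rwa [δ.inv_inv]), fun δ' hδ' => ?_⟩
      rw [← hu _ ((isVanillaForm_opposite_iff hΛ).1 hδ'), δ'.inv_inv]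
    · obtain ⟨h1, h2, h3, h4, h5, h6, h7, h8⟩ :=
        extremal_iff_plus hΛ ((isVanillaForm_opposite_iff hΛ).1 h)
      simp only [VanillaData.inv, isMinRep_longest_inv_iff, inv_eq_one] at h1 h2 h3 h4 h5 h6 h7 h8
      rw [isAbsMin_minus_iff hΛ tH, isAbsMin_minus_iff hΛ tL, isAbsMin_minus_iff hΛ tR,
        isAbsMin_minus_iff hΛ tJ, isAbsMax_minus_iff hΛ tH, isAbsMax_minus_iff hΛ tL,
        isAbsMax_minus_iff hΛ tR, isAbsMax_minus_iff hΛ tJ]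
      -- Inversion swaps 𝓛 with 𝓡 and σ₋ with σ₊, so the 𝓛 and 𝓡 criteria trade places.
      refine ⟨h1, h3.trans and_comm, h2.trans and_comm, h4.trans ?_, h5, h7.trans and_comm,
        h6.trans and_comm, h8.trans ?_⟩
      · exact ⟨fun h => ⟨h.2.2, h.2.1, h.1⟩, fun h => ⟨h.2.2, h.2.1, h.1⟩⟩
      · exact ⟨fun h => ⟨h.2.2, h.2.1, h.1⟩, fun h => ⟨h.2.2, h.2.1, h.1⟩⟩
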